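/- Fix an integer $k$, a vector $\rho\in(0,1)^k$ with $\sum_{i=1}^k\rho_i=1$ (so $k\ge 2$), a symmetric matrix $P\in(0,1)^{k\times k}$, and $t>0$. For $n\in\mathbb N$ let $(\sigma_0,G)$ be drawn from the $k$-community censored stochastic block model $\mathrm{CSBM}_n^k(\rho,P,t)$: the communities $\sigma_0(v)\in[k]$, $v\in[n]$, are independent with $\mathbb P(\sigma_0(v)=i)=\rho_i$; given $\sigma_0$, independently for all pairs $\{u,v\}$ of distinct vertices, the edge $\{u,v\}$ exists with probability $P_{\sigma_0(u)\sigma_0(v)}$ and, independently of this, its status is revealed with probability $\min\{1,\frac{t\log n}{n}\}$ (which is $\frac{t\log n}{n}$ for all large $n$) and is censored otherwise. The graph $G$ records for every pair whether it is present, absent or censored; $\sigma_0$ is not observed. An estimator $\hat\sigma$ is a sequence of (possibly randomized) maps, one for each $n$, that take $G$ to an assignment $\hat\sigma:[n]\to[k]$; any randomness of $\hat\sigma$ is independent of $\sigma_0$ given $G$. For an assignment $\sigma$ let $S(\sigma)$ be the $n\times k$ matrix with entries $S(\sigma)_{ui}=\mathbf 1\{\sigma(u)=i\}$. The estimator achieves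 exact recovery if there is a $k\times k$ permutation matrix $J$ with $S(\hat\sigma)J=S(\sigma_0)$. For vectors $\mu,\nu$ with positive entries indexed by a finite set, let $$\Delta_+(\mu,\nu)=\max_{\xi\in[0,1]}\sum_{l}\big[\xi\mu_l+(1-\xi)\nu_l-\mu_l^{\xi}\nu_l^{1-\xi}\big]$$ be the Chernoff–Hellinger divergence, let $\theta_i=(\rho_rP_{ri},\,\rho_r(1-P_{ri}))_{r\in[k]}\in\mathbb R^{2k}$, and let $$t_c=\Big(\min_{i\ne j}\Delta_+(\theta_i,\theta_j)\Big)^{-1},$$ where $t_c=\infty$ if the minimum is $0$. **Theorem 1.3.** If $t<t_c$, then for every estimator $\hat\sigma$, $$\lim_{n\to\infty}\mathbb P(\hat\sigma\text{ achieves exact recovery})=0.$$ -/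

import Mathlib

open Filter Topology
open scoped ENNReal

noncomputable section

namespace CSBM

/-- The three possible statuses of a pair of vertices in a censored graph. -/
inductive EdgeStatus where
  | present
  | absent
  | censored
  deriving DecidableEq

instance : Fintype EdgeStatus where
  elems := {.present, .absent, .censored}
  complete s := by cases s <;> decide

/-- The unordered pairs of distinct vertices `{u, v}` of `[n]`, each represented once as `u < v`. -/
abbrev VertexPair (n : ℕ) : Type := {e : Fin n × Fin n // e.1 < e.2}

/-- A censored graph on the vertex set `[n]`: a status for every pair of distinct vertices. -/
abbrev CensoredGraph (n : ℕ) : Type := VertexPair n → EdgeStatus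

/-- An assignment of communities in `[k]` to the vertices in `[n]`. -/
abbrev Assignment (n k : ℕ) : Type := Fin n → Fin k

/-- The parameters `ρ ∈ (0,1)^k` with `∑ ρ_i = 1` and `P ∈ (0,1)^{k × k}` symmetric. -/
structure Params (k : ℕ) where
  ρ : Fin k → ℝ
  P : Matrix (Fin k) (Fin k) ℝ
  ρ_mem : ∀ i, ρ i ∈ Set.Ioo (0 : ℝ) 1
  ρ_sum : ∑ i, ρ i = 1
  P_mem : ∀ i j, P i j ∈ Set.Ioo (0 : ℝ) 1
  P_symm : P.IsSymm

/-- The law of a family of independent random variables `(X_i)_{i ∈ ι}`, `X_i` of law `p i`. -/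
def independentLaw {ι α : Type} [Fintype ι] [DecidableEq ι] [Fintype α] (p : ι → PMF α) :
    PMF (ι → α) :=
  PMF.ofFintype (fun f => ∏ i, p i (f i)) (by
    have h := Finset.prod_univ_sum (fun _ : ι => (Finset.univ : Finset α)) (fun i a => p i a)
    rw [Fintype.piFinset_univ] at h
    rw [← h]
    refine Finset.prod_eq_one fun i _ => ?_
    rw [← tsum_fintype (L := .unconditional _)]
    exact (p i).tsum_coe)

/-- The law of the community of one vertex: community `i` has probability `ρ i`. -/
def communityLaw {k : ℕ} (M : Params k) : PMF (Fin k) :=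
  PMF.ofFintype (fun i => ENNReal.ofReal (M.ρ i)) (by
    rw [← ENNReal.ofReal_sum_of_nonneg fun i _ => (M.ρ_mem i).1.le, M.ρ_sum, ENNReal.ofReal_one])

/-- The law of the hidden assignment `σ₀`: the communities of the vertices are i.i.d. -/
def assignmentLaw {k : ℕ} (M : Params k) (n : ℕ) : PMF (Assignment n k) :=
  independentLaw fun _ : Fin n => communityLaw M

/-- The probability `t log n / n` that the status of a pair is revealed, truncated to `[0, 1]`. -/
def revealProb (t : ℝ) (n : ℕ) : Set.Icc (0 : ℝ) 1 :=
  Set.projIcc 0 1 zero_le_one (t * Real.log n / n)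

/-- The law of the status of one pair, when the edge exists with probability `p` and,
independently, its status is revealed with probability `q`. -/
def statusLaw (q p : Set.Icc (0 : ℝ) 1) : PMF EdgeStatus :=
  PMF.ofFintype
    (fun s => match s with
      | .present => ENNReal.ofReal (q * p)
      | .absent => ENNReal.ofReal (q * (1 - p))
      | .censored => ENNReal.ofReal (1 - q)) (by
    have hq := q.2
    have hp := p.2
    have h1 : (0 : ℝ) ≤ q * p := mul_nonneg hq.1 hp.1
    have h2 : (0 : ℝ) ≤ q * (1 - p) := mul_nonneg hq.1 (sub_nonneg.2 hp.2)
    have h3 : (0 : ℝ) ≤ 1 - q := sub_nonneg.2 hq.2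
    have hu : (Finset.univ : Finset EdgeStatus) = {.present, .absent, .censored} := rfl
    rw [hu, Finset.sum_insert (by decide), Finset.sum_insert (by decide), Finset.sum_singleton,
      ← ENNReal.ofReal_add h2 h3, ← ENNReal.ofReal_add h1 (add_nonneg h2 h3),
      ← ENNReal.ofReal_one]
    congr 1
    ring)

/-- The law of the censored graph given the assignment `σ`: the statuses of the pairs are
independent, and the edge `{u, v}` exists with probability `P_{σ(u) σ(v)}`. -/
def graphLaw {k : ℕ} (M : Params k) (t : ℝ) (n : ℕ) (σ : Assignment n k) :
    PMF (CensoredGraph n) :=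
  independentLaw fun e : VertexPair n =>
    statusLaw (revealProb t n)
      ⟨M.P (σ e.1.1) (σ e.1.2), Set.Ioo_subset_Icc_self (M.P_mem _ _)⟩

/-- The joint law of `(σ₀, G)` in the censored stochastic block model. -/
def modelLaw {k : ℕ} (M : Params k) (t : ℝ) (n : ℕ) :
    PMF (Assignment n k × CensoredGraph n) :=
  (assignmentLaw M n).bind fun σ => (graphLaw M t n σ).map fun G => (σ, G)

/-- A (possibly randomized) estimator: it sees only the censored graph, and outputs a random
assignment. A deterministic estimator is one all of whose values are point masses. -/
abbrev Estimator (n k : ℕ) : Type := CensoredGraph n → PMF (Assignment n k)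

/-- The `n × k` membership matrix of an assignment. -/
def membershipMatrix {n k : ℕ} (σ : Assignment n k) : Matrix (Fin n) (Fin k) ℝ :=
  Matrix.of fun u i => if σ u = i then 1 else 0

/-- The assignment `σhat` recovers `σ₀` exactly, up to a relabelling of the communities. -/
def ExactRecovery {n k : ℕ} (σhat σ₀ : Assignment n k) : Prop :=
  ∃ π : Equiv.Perm (Fin k),
    membershipMatrix σhat * (π.permMatrix ℝ : Matrix (Fin k) (Fin k) ℝ) = membershipMatrix σ₀

/-- The joint law of `(σ₀, σhat)`, where `σhat` is the output of the estimator on `G`. -/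
def outputLaw {k : ℕ} (M : Params k) (t : ℝ) (n : ℕ) (est : Estimator n k) :
    PMF (Assignment n k × Assignment n k) :=
  (modelLaw M t n).bind fun x => (est x.2).map fun τ => (x.1, τ)

/-- The probability that the estimator achieves exact recovery. -/
def recoveryProb {k : ℕ} (M : Params k) (t : ℝ) (n : ℕ) (est : Estimator n k) : ℝ≥0∞ :=
  (outputLaw M t n est).toMeasure {x | ExactRecovery x.2 x.1}

/-- `CH_ξ(μ, ν) = ∑_i [ξ μ_i + (1 - ξ) ν_i - μ_i^ξ ν_i^{1-ξ}]`. -/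
def chernoffHellingerAt {ι : Type} [Fintype ι] (ξ : ℝ) (μ ν : ι → ℝ) : ℝ :=
  ∑ i, (ξ * μ i + (1 - ξ) * ν i - μ i ^ ξ * ν i ^ (1 - ξ))

/-- The Chernoff–Hellinger divergence `Δ₊(μ, ν)`: the maximum of `CH_ξ(μ, ν)` over `ξ ∈ [0, 1]`. -/
def chernoffHellinger {ι : Type} [Fintype ι] (μ ν : ι → ℝ) : ℝ :=
  sSup ((fun ξ => chernoffHellingerAt ξ μ ν) '' Set.Icc (0 : ℝ) 1)

/-- For vectors with positive entries the supremum is attained. -/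
theorem isGreatest_chernoffHellinger {ι : Type} [Fintype ι] {μ ν : ι → ℝ}
    (hμ : ∀ i, 0 < μ i) (hν : ∀ i, 0 < ν i) :
    IsGreatest ((fun ξ => chernoffHellingerAt ξ μ ν) '' Set.Icc (0 : ℝ) 1)
      (chernoffHellinger μ ν) := by
  refine (isCompact_Icc.image ?_).isGreatest_sSup
    ((Set.nonempty_Icc.2 zero_le_one).image _)
  unfold chernoffHellingerAt
  refine continuous_finsetSum _ fun i _ => ?_
  have h1 : Continuous fun ξ : ℝ => μ i ^ ξ :=
    continuous_const.rpow continuous_id fun _ => Or.inl (hμ i).ne'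
  have h2 : Continuous fun ξ : ℝ => ν i ^ (1 - ξ) :=
    continuous_const.rpow (continuous_const.sub continuous_id) fun _ => Or.inl (hν i).ne'
  fun_prop

/-- The vector `θ_i = (ρ_r P_{ri}, ρ_r (1 - P_{ri}))_{r ∈ [k]} ∈ ℝ^{2k}`, with `Sum.inl r` and
`Sum.inr r` indexing the two entries that belong to `r`. -/
def profileVector {k : ℕ} (M : Params k) (i : Fin k) : Fin k ⊕ Fin k → ℝ :=
  Sum.elim (fun r => M.ρ r * M.P r i) (fun r => M.ρ r * (1 - M.P r i))

/-- The threshold `t_c = (min_{i ≠ j} Δ₊(θ_i, θ_j))⁻¹`, with value `∞` if the minimum is `0`. -/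
def criticalTime {k : ℕ} (M : Params k) : ℝ≥0∞ :=
  (⨅ (i : Fin k) (j : Fin k) (_ : i ≠ j),
    ENNReal.ofReal (chernoffHellinger (profileVector M i) (profileVector M j)))⁻¹

end CSBM

end

/-! Below the threshold some pair `i ≠ j` has `t * Δ₊(θ_i, θ_j) < 1`, and then many vertices of
community `i` could be moved to `j` without lowering the likelihood of the graph. The true
assignment thus competes with many others of comparable posterior mass, while a single guess covers
at most `k!` assignments, so no estimator succeeds.

To make these vertices nearly independent, only the first `s = ⌊n^β⌋` vertices are considered, with
`β < 1`. The pairs from such a vertex `v` to the remaining vertices are disjoint for different `v`,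
so given `σ₀` the events `crossFavours` are independent. The pairs of `v` inside the small set are
all censored (`innerCensored`) except with probability at most `s * t log n / n`, which tends to
`0`. On both events the move costs only the prior factor (`jointMass_le_update`).

The quantitative input is `exists_le_graphLaw_real_crossFavours`: `crossFavours` has probability at
least `n^(-γ)` with `γ < 1`. It is Cramér's lower bound: tilt the law of the log-likelihood ratio by
a `θ` that makes its mean positive but small compared with `log n`, apply Chebyshev under the tilted
law, and change measure back (`le_independentLaw_real_sum_nonneg`). The normalizing product yields
the exponent `t * CH_{1-θ}(θ_i, θ_j)`. Only the bound of this by `t * Δ₊` is needed, so `θ` need not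
be identified as the maximizer.

With `γ < β`, the expected number of such vertices is at least of order `n^(β-γ)`. A second moment
bound (`measureReal_count_deviation_le`) makes the actual number diverge in probability, and
`recoveryProb_le` turns this into failure of recovery. -/

namespace CSBM

open MeasureTheory ProbabilityTheory

/-! ### Product laws on finite types and independence of disjoint blocks. -/

section IndependentLaw

variable {ι α : Type} [Fintype ι] [DecidableEq ι] [Fintype α]

theorem independentLaw_apply (p : ι → PMF α) (x : ι → α) :
    independentLaw p x = ∏ i, p i (x i) := rfl

variable [MeasurableSpace α] [MeasurableSingletonClass α]

theorem toMeasure_independentLaw (p : ι → PMF α) :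
    (independentLaw p).toMeasure = Measure.pi fun i => (p i).toMeasure := by
  refine Measure.ext_of_singleton fun x => ?_
  rw [PMF.toMeasure_apply_singleton _ _ (measurableSet_singleton x), Measure.pi_singleton,
    independentLaw_apply]
  exact Finset.prod_congr rfl fun i _ =>
    (PMF.toMeasure_apply_singleton _ _ (measurableSet_singleton _)).symm

/-- Events that are determined by disjoint sets of coordinates are independent. -/
theorem independentLaw_real_inter (p : ι → PMF α) {S T : Finset ι} (hST : Disjoint S T)
    {A B : Set (ι → α)} (hA : ∀ x y : ι → α, (∀ i ∈ S, x i = y i) → x ∈ A → y ∈ A)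
    (hB : ∀ x y : ι → α, (∀ i ∈ T, x i = y i) → x ∈ B → y ∈ B) :
    (independentLaw p).toMeasure.real (A ∩ B) =
      (independentLaw p).toMeasure.real A * (independentLaw p).toMeasure.real B := by
  have hind : iIndepFun (fun i (x : ι → α) => x i) (independentLaw p).toMeasure := by
    rw [toMeasure_independentLaw]
    exact iIndepFun_pi (X := fun _ a => a) fun i => aemeasurable_id
  have h := hind.indepFun_finset S T hST fun i => measurable_pi_apply i
  -- An event that depends only on the coordinates in `S` is the preimage of its image under
  -- restriction to `S`.
  have key : ∀ (S : Finset ι) (A : Set (ι → α)),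
      (∀ x y : ι → α, (∀ i ∈ S, x i = y i) → x ∈ A → y ∈ A) →
      A = (fun (a : ι → α) (i : S) => a i) ⁻¹' ((fun (a : ι → α) (i : S) => a i) '' A) := by
    intro S A hA
    refine (Set.subset_preimage_image _ _).antisymm ?_
    rintro y ⟨x, hx, hxy⟩
    exact hA x y (fun i hi => congrFun hxy ⟨i, hi⟩) hx
  rw [key S A hA, key T B hB]
  simp only [measureReal_def]
  rw [h.measure_inter_preimage_eq_mul _ _ (Set.toFinite _).measurableSet
    (Set.toFinite _).measurableSet, ENNReal.toReal_mul]

end IndependentLaw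

/-! ### A second moment bound for counts. -/

section Counting

variable {Ω ι : Type*} [MeasurableSpace Ω] [Finite Ω] [MeasurableSingletonClass Ω]

open Classical in
/-- A second moment bound for the number of events `B v` that occur, when `B v` makes up most of
an event `D v` and the events `D v` are pairwise independent. -/
theorem measureReal_count_deviation_le (μ : Measure Ω) [IsProbabilityMeasure μ] (V : Finset ι)
    (B D : ι → Set Ω) (ε : ℝ) (hBD : ∀ v ∈ V, B v ⊆ D v)
    (hind : ∀ v ∈ V, ∀ w ∈ V, v ≠ w → μ.real (D v ∩ D w) = μ.real (D v) * μ.real (D w))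
    (hB : ∀ v ∈ V, (1 - ε) * μ.real (D v) ≤ μ.real (B v)) {x : ℝ} (hx : 0 < x) :
    μ.real {ω | x ≤ |((V.filter fun v => ω ∈ B v).card : ℝ) - ∑ v ∈ V, μ.real (D v)|} ≤
      ((∑ v ∈ V, μ.real (D v)) + 2 * ε * (∑ v ∈ V, μ.real (D v)) ^ 2) / x ^ 2 := by
  set a := ∑ v ∈ V, μ.real (D v) with ha
  have ha0 : 0 ≤ a := Finset.sum_nonneg fun v _ => measureReal_nonneg
  have hms : ∀ s : Set Ω, MeasurableSet s := fun s => s.toFinite.measurableSet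
  have hint : ∀ f : Ω → ℝ, Integrable f μ := fun f => Integrable.of_finite
  set Z : Ω → ℝ := fun ω => ((V.filter fun v => ω ∈ B v).card : ℝ) with hZ
  have hZs : ∀ ω, Z ω = ∑ v ∈ V, (B v).indicator (fun _ => (1 : ℝ)) ω := by
    intro ω
    simp only [hZ, Finset.card_filter, Nat.cast_sum, Set.indicator_apply]
    exact Finset.sum_congr rfl fun v _ => by split_ifs <;> simp
  have hEZ : ∫ ω, Z ω ∂μ = ∑ v ∈ V, μ.real (B v) := by
    simp_rw [hZs]
    rw [integral_finsetSum _ fun v _ => hint _]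
    exact Finset.sum_congr rfl fun v _ => integral_indicator_one (hms _)
  have hEZ2 : ∫ ω, Z ω ^ 2 ∂μ = ∑ v ∈ V, ∑ w ∈ V, μ.real (B v ∩ B w) := by
    have : ∀ ω, Z ω ^ 2 = ∑ v ∈ V, ∑ w ∈ V, (B v ∩ B w).indicator (fun _ => (1 : ℝ)) ω := by
      intro ω
      rw [sq, hZs, Finset.sum_mul_sum]
      refine Finset.sum_congr rfl fun v _ => Finset.sum_congr rfl fun w _ => ?_
      simp only [Set.indicator_apply, Set.mem_inter_iff]
      split_ifs <;> simp_all
    simp_rw [this]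
    rw [integral_finsetSum _ fun v _ => hint _]
    refine Finset.sum_congr rfl fun v _ => ?_
    rw [integral_finsetSum _ fun v _ => hint _]
    exact Finset.sum_congr rfl fun w _ => integral_indicator_one (hms _)
  -- The events `B v` need not be independent, so each `B v ∩ B w` is enlarged to `D v ∩ D w` before
  -- factoring. The loss is paid only in the first moment, through `ε`.
  have h2 : ∫ ω, Z ω ^ 2 ∂μ ≤ a ^ 2 + a := by
    rw [hEZ2]
    calc ∑ v ∈ V, ∑ w ∈ V, μ.real (B v ∩ B w)
        ≤ ∑ v ∈ V, ∑ w ∈ V, (μ.real (D v) * μ.real (D w) + if v = w then μ.real (D v) else 0) := by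
          refine Finset.sum_le_sum fun v hv => Finset.sum_le_sum fun w hw => ?_
          split_ifs with hvw
          · subst hvw
            rw [Set.inter_self]
            exact (measureReal_mono (hBD v hv)).trans
              (le_add_of_nonneg_left (mul_nonneg measureReal_nonneg measureReal_nonneg))
          · rw [add_zero, ← hind v hv w hw hvw]
            exact measureReal_mono (Set.inter_subset_inter (hBD v hv) (hBD w hw))
      _ = a ^ 2 + a := by
          simp only [Finset.sum_add_distrib, sq, ha, Finset.sum_mul_sum]
          congr 1
          exact Finset.sum_congr rfl fun v hv => by simp [hv]
  have h1 : (1 - ε) * a ≤ ∫ ω, Z ω ∂μ := by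
    rw [hEZ, ha, Finset.mul_sum]
    exact Finset.sum_le_sum hB
  have hdev : ∫ ω, (Z ω - a) ^ 2 ∂μ ≤ a + 2 * ε * a ^ 2 := by
    have : ∫ ω, (Z ω - a) ^ 2 ∂μ = ∫ ω, Z ω ^ 2 ∂μ - 2 * a * ∫ ω, Z ω ∂μ + a ^ 2 := by
      have e : ∀ ω, (Z ω - a) ^ 2 = Z ω ^ 2 - 2 * a * Z ω + a ^ 2 := fun ω => by ring
      simp_rw [e]
      rw [integral_add (hint _) (hint _), integral_sub (hint _) (hint _), integral_const_mul]
      simp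
    rw [this]
    nlinarith
  have hM := mul_meas_ge_le_integral_of_nonneg (μ := μ) (f := fun ω => (Z ω - a) ^ 2)
    (Eventually.of_forall fun ω => sq_nonneg _) (hint _) (x ^ 2)
  rw [le_div_iff₀ (by positivity), mul_comm]
  refine le_trans (mul_le_mul_of_nonneg_left (measureReal_mono fun ω hω => ?_)
    (sq_nonneg x)) (hM.trans hdev)
  have : x ≤ |Z ω - a| := hω
  change x ^ 2 ≤ (Z ω - a) ^ 2
  rw [← sq_abs (Z ω - a)]
  exact pow_le_pow_left₀ hx.le this 2

end Counting

/-! ### Exponential tilting and a Cramér-type lower bound. -/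

section Tilting

variable {ι α : Type} [Fintype ι] [DecidableEq ι] [Fintype α]

theorem pmf_sum_toReal (p : PMF α) : ∑ x, (p x).toReal = 1 := by
  have h := p.tsum_coe
  rw [tsum_fintype] at h
  rw [← ENNReal.toReal_sum fun x _ => p.apply_ne_top x, h, ENNReal.toReal_one]

/-- The exponential tilting of a law on a finite type. -/
noncomputable def tiltedLaw (p : PMF α) (f : α → ℝ) : PMF α :=
  PMF.ofFintype (fun x => ENNReal.ofReal
      ((p x).toReal * Real.exp (f x) / ∑ y, (p y).toReal * Real.exp (f y))) (by
    have h0 : ∀ y, 0 ≤ (p y).toReal * Real.exp (f y) := fun y => by positivity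
    rw [← ENNReal.ofReal_sum_of_nonneg fun x _ =>
      div_nonneg (h0 x) (Finset.sum_nonneg fun y _ => h0 y), ← Finset.sum_div, div_self,
      ENNReal.ofReal_one]
    intro h
    rw [Finset.sum_eq_zero_iff_of_nonneg fun y _ => h0 y] at h
    have h1 := pmf_sum_toReal p
    rw [Finset.sum_eq_zero] at h1
    · exact zero_ne_one h1
    · intro x hx
      exact (mul_eq_zero.1 (h x hx)).resolve_right (Real.exp_ne_zero _))

theorem tiltedLaw_apply_toReal (p : PMF α) (f : α → ℝ) (x : α) :
    (tiltedLaw p f x).toReal =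
      (p x).toReal * Real.exp (f x) / ∑ y, (p y).toReal * Real.exp (f y) := by
  refine ENNReal.toReal_ofReal (div_nonneg (by positivity) (Finset.sum_nonneg fun y _ => ?_))
  positivity

theorem sum_mul_exp_pos (p : PMF α) (f : α → ℝ) :
    0 < ∑ y, (p y).toReal * Real.exp (f y) := by
  obtain ⟨x, hx⟩ := p.support_nonempty
  have hx' : 0 < (p x).toReal :=
    ENNReal.toReal_pos ((PMF.mem_support_iff _ _).1 hx) (p.apply_ne_top x)
  refine Finset.sum_pos' (fun y _ => by positivity) ⟨x, Finset.mem_univ x, by positivity⟩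

variable [MeasurableSpace α] [MeasurableSingletonClass α]

theorem pmf_measureReal_eq_sum (p : PMF α) (A : Set α) :
    p.toMeasure.real A = ∑ x, A.indicator (fun x => (p x).toReal) x := by
  rw [measureReal_def, PMF.toMeasure_apply_fintype,
    ENNReal.toReal_sum fun x _ => ?_]
  · refine Finset.sum_congr rfl fun x _ => ?_
    by_cases hx : x ∈ A <;> simp [hx]
  · by_cases hx : x ∈ A <;> simp [hx, p.apply_ne_top]

/-- A lower bound of large deviation type, by exponential tilting: the probability that a sum of
independent variables is nonnegative. -/
theorem le_independentLaw_real_sum_nonneg (p : ι → PMF α) (l : ι → α → ℝ) {θ m V : ℝ}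
    (hθ : θ ∈ Set.Icc (0 : ℝ) 1) (hm : 0 < m)
    (hmean : ∑ i, (∑ x, (p i x).toReal * Real.exp (θ * l i x) * l i x) /
      (∑ x, (p i x).toReal * Real.exp (θ * l i x)) = m)
    (hvar : ∑ i, (∑ x, (p i x).toReal * Real.exp (θ * l i x) * l i x ^ 2) /
      (∑ x, (p i x).toReal * Real.exp (θ * l i x)) ≤ V) :
    (∏ i, ∑ x, (p i x).toReal * Real.exp (θ * l i x)) * Real.exp (-(2 * m)) * (1 - V / m ^ 2) ≤
      (independentLaw p).toMeasure.real {x | 0 ≤ ∑ i, l i (x i)} := by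
  set g : ι → PMF α := fun i => tiltedLaw (p i) fun x => θ * l i x with hg
  set Q := (independentLaw g).toMeasure with hQ
  set Zf : ι → ℝ := fun i => ∑ x, (p i x).toReal * Real.exp (θ * l i x) with hZf
  have hZpos : ∀ i, 0 < Zf i := fun i => sum_mul_exp_pos _ _
  have hQpi : Q = Measure.pi fun i => (g i).toMeasure := toMeasure_independentLaw g
  set L : (ι → α) → ℝ := ∑ i, fun x => l i (x i) with hL
  have hLx : ∀ x, L x = ∑ i, l i (x i) := fun x => by simp [hL]
  have hgint : ∀ i (f : α → ℝ), ∫ x, f x ∂(g i).toMeasure =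
      (∑ x, (p i x).toReal * Real.exp (θ * l i x) * f x) / Zf i := by
    intro i f
    rw [PMF.integral_eq_sum, Finset.sum_div]
    refine Finset.sum_congr rfl fun x _ => ?_
    rw [hg, tiltedLaw_apply_toReal, smul_eq_mul]
    simp only [hZf]
    ring
  have hmem : ∀ i, MemLp (l i) 2 (g i).toMeasure := fun i => MemLp.of_discrete
  have hVar : Var[L; Q] ≤ V := by
    rw [hQpi, hL, variance_sum_pi hmem]
    refine le_trans (Finset.sum_le_sum fun i _ => ?_) hvar
    refine (variance_le_expectation_sq (hmem i).1).trans_eq ?_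
    exact hgint i fun x => l i x ^ 2
  have hE : ∫ x, L x ∂Q = m := by
    simp_rw [hLx]
    rw [integral_finsetSum _ fun i _ => Integrable.of_finite, ← hmean]
    refine Finset.sum_congr rfl fun i _ => ?_
    rw [hQpi, ← hgint i (l i)]
    exact integral_comp_eval (μ := fun i => (g i).toMeasure) (f := l i)
      Integrable.of_finite.aestronglyMeasurable
  have hcheb : Q.real {x | m ≤ |L x - m|} ≤ V / m ^ 2 := by
    have h := meas_ge_le_variance_div_sq (μ := Q) (X := L) MemLp.of_discrete hm
    rw [hE] at h
    have h' := ENNReal.toReal_le_of_le_ofReal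
      (div_nonneg (variance_nonneg _ _) (sq_nonneg m)) h
    exact h'.trans (div_le_div_of_nonneg_right hVar (sq_nonneg m))
  -- The window of radius `m` about the tilted mean: its lower end gives the desired event, its
  -- upper end bounds the density `∏ Zf i * exp (-θ L)` of the original law from below.
  set A : Set (ι → α) := {x | 0 ≤ L x ∧ L x ≤ 2 * m} with hA
  have hQA : 1 - V / m ^ 2 ≤ Q.real A := by
    have h1 : Q.real Aᶜ ≤ V / m ^ 2 := by
      refine le_trans (measureReal_mono fun x hx => ?_) hcheb
      have hx' : ¬ (0 ≤ L x ∧ L x ≤ 2 * m) := hx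
      change m ≤ |L x - m|
      by_contra! h
      rw [abs_lt] at h
      exact hx' ⟨by linarith, by linarith⟩
    rw [probReal_compl_eq_one_sub A.toFinite.measurableSet] at h1
    linarith
  calc _ ≤ (∏ i, Zf i) * Real.exp (-(2 * m)) * Q.real A :=
        mul_le_mul_of_nonneg_left hQA
          (mul_nonneg (Finset.prod_nonneg fun i _ => (hZpos i).le) (Real.exp_pos _).le)
    _ ≤ (independentLaw p).toMeasure.real A := by
        rw [hQ, pmf_measureReal_eq_sum, pmf_measureReal_eq_sum, Finset.mul_sum]
        refine Finset.sum_le_sum fun x _ => ?_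
        by_cases hx : x ∈ A
        · rw [Set.indicator_of_mem hx, Set.indicator_of_mem hx, independentLaw_apply,
            independentLaw_apply, ENNReal.toReal_prod, ENNReal.toReal_prod]
          have e : ∏ i, (g i (x i)).toReal =
              (∏ i, (p i (x i)).toReal) * Real.exp (θ * L x) / ∏ i, Zf i := by
            rw [hLx, Finset.mul_sum, Real.exp_sum, ← Finset.prod_mul_distrib,
              ← Finset.prod_div_distrib]
            exact Finset.prod_congr rfl fun i _ => tiltedLaw_apply_toReal _ _ _
          have hp : 0 ≤ ∏ i, (p i (x i)).toReal :=
            Finset.prod_nonneg fun i _ => ENNReal.toReal_nonneg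
          have hZ0 : ∏ i, Zf i ≠ 0 := (Finset.prod_pos fun i _ => hZpos i).ne'
          have hle : Real.exp (-(2 * m)) * Real.exp (θ * L x) ≤ 1 := by
            rw [← Real.exp_add, Real.exp_le_one_iff]
            have := mul_le_of_le_one_left hx.1 hθ.2
            linarith [hx.2]
          rw [e]
          calc _ = (∏ i, (p i (x i)).toReal) * (Real.exp (-(2 * m)) * Real.exp (θ * L x)) := by
                field_simp
            _ ≤ _ := mul_le_of_le_one_right hp hle
        · rw [Set.indicator_of_notMem hx, Set.indicator_of_notMem hx, mul_zero]
    _ ≤ _ := measureReal_mono fun x hx => by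
        have := hx.1
        rwa [hLx] at this

end Tilting

/-! ### Likelihood-preserving moves and the posterior bound. -/

instance : MeasurableSpace EdgeStatus := ⊤

instance : DiscreteMeasurableSpace EdgeStatus := ⟨fun _ => trivial⟩

section Model

variable {k : ℕ} (M : Params k) (t : ℝ) {n : ℕ}

/-- The law of the status of a pair of vertices in the communities `a` and `b`. -/
noncomputable def edgeLaw (n : ℕ) (a b : Fin k) : PMF EdgeStatus :=
  statusLaw (revealProb t n) ⟨M.P a b, Set.Ioo_subset_Icc_self (M.P_mem _ _)⟩

/-- The joint mass of an assignment and a censored graph. -/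
noncomputable def jointMass (σ : Assignment n k) (G : CensoredGraph n) : ℝ≥0∞ :=
  assignmentLaw M n σ * graphLaw M t n σ G

theorem graphLaw_eq (σ : Assignment n k) :
    graphLaw M t n σ = independentLaw fun e => edgeLaw M t n (σ e.1.1) (σ e.1.2) := rfl

theorem graphLaw_apply (σ : Assignment n k) (G : CensoredGraph n) :
    graphLaw M t n σ G = ∏ e, edgeLaw M t n (σ e.1.1) (σ e.1.2) (G e) := rfl

theorem assignmentLaw_apply (σ : Assignment n k) :
    assignmentLaw M n σ = ∏ v, ENNReal.ofReal (M.ρ (σ v)) := rfl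

theorem edgeLaw_apply_censored (a b : Fin k) :
    edgeLaw M t n a b .censored = ENNReal.ofReal (1 - revealProb t n) := rfl

/-- The pairs that join `v` to a vertex outside of the first `s` vertices. -/
def crossPairs (s : ℕ) (v : Fin n) : Finset (VertexPair n) :=
  Finset.univ.filter fun e => e.1.1 = v ∧ s ≤ e.1.2.val

/-- The pairs of vertices among the first `s` vertices that contain `v`. -/
def innerPairs (s : ℕ) (v : Fin n) : Finset (VertexPair n) :=
  Finset.univ.filter fun e => e.1.2.val < s ∧ (e.1.1 = v ∨ e.1.2 = v)

/-- The graphs whose pairs between `v` and the vertices outside of the first `s` vertices are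
at least as likely when `v` is moved to the community `j`. -/
def crossFavours (s : ℕ) (σ : Assignment n k) (j : Fin k) (v : Fin n) : Set (CensoredGraph n) :=
  {G | ∏ e ∈ crossPairs s v, edgeLaw M t n (σ v) (σ e.1.2) (G e) ≤
    ∏ e ∈ crossPairs s v, edgeLaw M t n j (σ e.1.2) (G e)}

/-- The graphs in which all pairs of `v` with the first `s` vertices are censored. -/
def innerCensored (s : ℕ) (v : Fin n) : Set (CensoredGraph n) :=
  {G | ∀ e ∈ innerPairs s v, G e = .censored}

/-- Three kinds of pairs: those in `crossPairs` gain by assumption, those in `innerPairs` are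
censored and have a mass independent of the communities, and the rest avoid `v`. As `v < s`, a pair
of `v` with an outer vertex always has `v` as first entry. -/
theorem graphLaw_le_update {s : ℕ} {σ : Assignment n k} {j : Fin k} {v : Fin n}
    (hv : v.val < s) {G : CensoredGraph n} (hD : G ∈ crossFavours M t s σ j v)
    (hI : G ∈ innerCensored s v) :
    graphLaw M t n σ G ≤ graphLaw M t n (Function.update σ v j) G := by
  classical
  rw [graphLaw_apply, graphLaw_apply,
    ← Finset.prod_mul_prod_compl (crossPairs s v) fun e => edgeLaw M t n (σ e.1.1) (σ e.1.2) (G e),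
    ← Finset.prod_mul_prod_compl (crossPairs s v)]
  refine mul_le_mul' ?_ (Finset.prod_congr rfl fun e he => ?_).le
  · refine (Finset.prod_congr rfl fun e he => ?_).trans_le
      (le_trans hD (Finset.prod_congr rfl fun e he => ?_).le)
    · rw [(Finset.mem_filter.1 he).2.1]
    · obtain ⟨h1, h2⟩ := (Finset.mem_filter.1 he).2
      have h3 : e.1.2 ≠ v := fun h => by rw [h] at h2; omega
      rw [h1, Function.update_self, Function.update_of_ne h3]
  · by_cases hin : e ∈ innerPairs s v
    · rw [hI e hin, edgeLaw_apply_censored, edgeLaw_apply_censored]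
    · simp only [crossPairs, innerPairs, Finset.mem_compl, Finset.mem_filter, Finset.mem_univ,
        true_and, not_and, not_or, not_le] at he hin
      have h1 : e.1.1 ≠ v := fun h => (hin (he h)).1 h
      have h2 : e.1.2 ≠ v := fun h => (hin (by rw [h]; exact hv)).2 h
      rw [Function.update_of_ne h1, Function.update_of_ne h2]

/-- The prior changes by the factor `ρ j / ρ (σ v)`, which is at least `ρ j`. -/
theorem jointMass_le_update {s : ℕ} {σ : Assignment n k} {j : Fin k} {v : Fin n}
    (hv : v.val < s) {G : CensoredGraph n} (hD : G ∈ crossFavours M t s σ j v)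
    (hI : G ∈ innerCensored s v) :
    ENNReal.ofReal (M.ρ j) * jointMass M t σ G ≤ jointMass M t (Function.update σ v j) G := by
  rw [jointMass, jointMass, ← mul_assoc]
  refine mul_le_mul' ?_ (graphLaw_le_update M t hv hD hI)
  rw [assignmentLaw_apply, assignmentLaw_apply, ← Finset.mul_prod_erase _ _ (Finset.mem_univ v),
    ← Finset.mul_prod_erase _ (fun u => ENNReal.ofReal (M.ρ (Function.update σ v j u)))
      (Finset.mem_univ v), Function.update_self]
  refine mul_le_mul' le_rfl ?_
  calc _ ≤ 1 * ∏ u ∈ Finset.univ.erase v, ENNReal.ofReal (M.ρ (σ u)) :=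
        mul_le_mul' (ENNReal.ofReal_le_one.2 (M.ρ_mem _).2.le) le_rfl
    _ = _ := by
        rw [one_mul]
        refine Finset.prod_congr rfl fun u hu => ?_
        rw [Function.update_of_ne (Finset.ne_of_mem_erase hu)]

/-- The vertices of the community `i` among the first `s` vertices. -/
def initialMembers (s : ℕ) (σ : Assignment n k) (i : Fin k) : Finset (Fin n) :=
  Finset.univ.filter fun v => v.val < s ∧ σ v = i

open Classical in
/-- The number of vertices of the community `i` among the first `s` vertices for which the move
to the community `j` is seen to cost no likelihood. -/
noncomputable def flipCount (s : ℕ) (i j : Fin k) (σ : Assignment n k) (G : CensoredGraph n) : ℕ :=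
  ((initialMembers s σ i).filter fun v => G ∈ crossFavours M t s σ j v ∩ innerCensored s v).card

/-- Moves of different vertices give different assignments because `i ≠ j`, so their joint masses
add up inside the marginal mass of `G`. -/
theorem flipCount_mul_jointMass_le {s : ℕ} {i j : Fin k} (hij : i ≠ j) (σ : Assignment n k)
    (G : CensoredGraph n) :
    (flipCount M t s i j σ G : ℝ≥0∞) * (ENNReal.ofReal (M.ρ j) * jointMass M t σ G) ≤
      ∑ τ, jointMass M t τ G := by
  classical
  rw [flipCount, ← nsmul_eq_mul, ← Finset.sum_const]
  set F := (initialMembers s σ i).filter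
    fun v => G ∈ crossFavours M t s σ j v ∩ innerCensored s v with hF
  have hinj : Set.InjOn (fun v => Function.update σ v j) (F : Set (Fin n)) := by
    intro v hv w hw hvw
    by_contra hne
    have h := congrFun hvw v
    simp only [Function.update_self, Function.update_of_ne hne] at h
    have hv' := (Finset.mem_filter.1 (Finset.mem_filter.1 (Finset.mem_coe.1 hv)).1).2.2
    exact hij (hv'.symm.trans h.symm)
  calc _ ≤ ∑ v ∈ F, jointMass M t (Function.update σ v j) G := by
        refine Finset.sum_le_sum fun v hv => ?_
        obtain ⟨h1, h2⟩ := Finset.mem_filter.1 hv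
        exact jointMass_le_update M t (Finset.mem_filter.1 h1).2.1 h2.1 h2.2
    _ = ∑ τ ∈ F.image fun v => Function.update σ v j, jointMass M t τ G :=
        (Finset.sum_image (f := fun τ => jointMass M t τ G) hinj).symm
    _ ≤ _ := Finset.sum_le_univ_sum_of_nonneg fun _ => zero_le

theorem ExactRecovery.exists_perm {τ σ : Assignment n k} (h : ExactRecovery τ σ) :
    ∃ π : Equiv.Perm (Fin k), σ = π ∘ τ := by
  obtain ⟨π, hπ⟩ := h
  refine ⟨π, funext fun u => ?_⟩
  have h := congrFun (congrFun hπ u) (σ u)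
  simp only [Matrix.mul_apply, membershipMatrix, Matrix.of_apply, ite_mul, one_mul, zero_mul,
    Finset.sum_ite_eq, Finset.mem_univ, if_true, Equiv.Perm.permMatrix,
    PEquiv.toMatrix_apply] at h
  by_contra hne
  rw [if_neg] at h
  · exact zero_ne_one h
  · intro hmem
    rw [Equiv.toPEquiv_apply, Option.mem_some_iff] at hmem
    exact hne hmem.symm

open Classical in
theorem card_exactRecovery_le (τ : Assignment n k) :
    (Finset.univ.filter fun σ => ExactRecovery τ σ).card ≤ k.factorial := by
  calc _ ≤ (Finset.univ.image fun π : Equiv.Perm (Fin k) => (π ∘ τ : Assignment n k)).card := by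
        refine Finset.card_le_card fun σ hσ => ?_
        obtain ⟨π, hπ⟩ := (Finset.mem_filter.1 hσ).2.exists_perm
        exact Finset.mem_image.2 ⟨π, Finset.mem_univ _, hπ.symm⟩
    _ ≤ Fintype.card (Equiv.Perm (Fin k)) := Finset.card_image_le
    _ = k.factorial := by rw [Fintype.card_perm, Fintype.card_fin]

theorem sum_sum_jointMass : ∑ G, ∑ σ, jointMass M t (n := n) σ G = 1 := by
  rw [Finset.sum_comm]
  simp only [jointMass, ← Finset.mul_sum]
  have h (p : Assignment n k) : ∑ G, graphLaw M t n p G = 1 := by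
    rw [← tsum_fintype (L := .unconditional _), PMF.tsum_coe]
  simp only [h, mul_one]
  rw [← tsum_fintype (L := .unconditional _), PMF.tsum_coe]

open Classical in
theorem recoveryProb_eq_sum (est : Estimator n k) :
    recoveryProb M t n est =
      ∑ σ, ∑ G, ∑ τ, jointMass M t σ G * if ExactRecovery τ σ then est G τ else 0 := by
  have hms : ∀ A : Set (Assignment n k × Assignment n k), MeasurableSet A :=
    fun A => A.toFinite.measurableSet
  rw [recoveryProb, outputLaw, modelLaw, PMF.bind_bind,
    PMF.toMeasure_bind_apply _ _ _ (hms _), tsum_fintype]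
  refine Finset.sum_congr rfl fun σ _ => ?_
  rw [PMF.bind_map, PMF.toMeasure_bind_apply _ _ _ (hms _), tsum_fintype, Finset.mul_sum]
  refine Finset.sum_congr rfl fun G _ => ?_
  rw [← Finset.mul_sum, jointMass, mul_assoc]
  congr 2
  rw [Function.comp_apply, PMF.toMeasure_map_apply _ _ _ (measurable_of_finite _) (hms _),
    PMF.toMeasure_apply_fintype]
  refine Finset.sum_congr rfl fun τ _ => ?_
  simp [Set.indicator_apply]

/-- Recovery can only succeed when few moves cost no likelihood: otherwise the hidden assignment
has small posterior mass. -/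
theorem recoveryProb_le (s : ℕ) {i j : Fin k} (hij : i ≠ j) {m : ℝ} (hm : 0 < m)
    (est : Estimator n k) :
    recoveryProb M t n est ≤
      ∑ σ, assignmentLaw M n σ *
          (graphLaw M t n σ).toMeasure {G | (flipCount M t s i j σ G : ℝ) < m} +
        k.factorial / ENNReal.ofReal (m * M.ρ j) := by
  classical
  have hκ : 0 < m * M.ρ j := mul_pos hm (M.ρ_mem j).1
  -- With at least `m` free moves the posterior probability of `σ` given `G` is at most `1 / (m * ρ
  -- j)`.
  have hpost : ∀ (σ : Assignment n k) (G : CensoredGraph n), m ≤ (flipCount M t s i j σ G : ℝ) →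
      jointMass M t σ G ≤ (∑ τ, jointMass M t τ G) / ENNReal.ofReal (m * M.ρ j) := by
    intro σ G h
    rw [ENNReal.le_div_iff_mul_le (Or.inl (by simpa using hκ)) (Or.inl ENNReal.ofReal_ne_top)]
    refine le_trans ?_ (flipCount_mul_jointMass_le M t (s := s) hij σ G)
    rw [ENNReal.ofReal_mul hm.le, mul_comm, mul_assoc]
    refine mul_le_mul' ?_ le_rfl
    rw [← ENNReal.ofReal_natCast]
    exact ENNReal.ofReal_le_ofReal h
  set c := ENNReal.ofReal (m * M.ρ j) with hc
  have hest : ∀ G, ∑ τ, est G τ = 1 := fun G => by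
    rw [← tsum_fintype (L := .unconditional _), PMF.tsum_coe]
  rw [recoveryProb_eq_sum]
  calc _ ≤ ∑ σ, ∑ G, ((if (flipCount M t s i j σ G : ℝ) < m then jointMass M t σ G else 0) +
          ∑ τ, (∑ τ', jointMass M t τ' G) / c * if ExactRecovery τ σ then est G τ else 0) := by
        refine Finset.sum_le_sum fun σ _ => Finset.sum_le_sum fun G _ => ?_
        split_ifs with h
        · refine le_trans ?_ le_self_add
          rw [← Finset.mul_sum]
          refine mul_le_of_le_one_right' ?_
          rw [← hest G]
          exact Finset.sum_le_sum fun τ _ => by split_ifs <;> simp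
        · rw [zero_add]
          exact Finset.sum_le_sum fun τ _ => mul_le_mul' (hpost σ G (not_lt.1 h)) le_rfl
    _ = ∑ σ, ∑ G, (if (flipCount M t s i j σ G : ℝ) < m then jointMass M t σ G else 0) +
        ∑ G, ∑ τ, ∑ σ, (∑ τ', jointMass M t τ' G) / c *
          if ExactRecovery τ σ then est G τ else 0 := by
        simp only [Finset.sum_add_distrib]
        congr 1
        rw [Finset.sum_comm]
        exact Finset.sum_congr rfl fun G _ => Finset.sum_comm
    _ ≤ _ := by
        refine add_le_add (Finset.sum_le_sum fun σ _ => ?_) ?_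
        · rw [PMF.toMeasure_apply_fintype, Finset.mul_sum]
          refine Finset.sum_le_sum fun G _ => ?_
          by_cases h : (flipCount M t s i j σ G : ℝ) < m <;> simp [h, jointMass]
        -- The posterior bound no longer depends on `σ`, so a fixed output `τ` is charged once for
        -- each of the at most `k!` assignments it recovers.
        · have h1 : ∀ G τ, ∑ σ, (∑ τ', jointMass M t τ' G) / c *
              (if ExactRecovery τ σ then est G τ else 0) ≤
              (∑ τ', jointMass M t τ' G) / c * (k.factorial * est G τ) := by
            intro G τ
            rw [← Finset.mul_sum, ← Finset.sum_filter, Finset.sum_const, nsmul_eq_mul]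
            gcongr
            exact card_exactRecovery_le τ
          calc _ ≤ ∑ G, ∑ τ, (∑ τ', jointMass M t τ' G) / c * (k.factorial * est G τ) :=
                Finset.sum_le_sum fun G _ => Finset.sum_le_sum fun τ _ => h1 G τ
            _ = ∑ G, (∑ τ', jointMass M t τ' G) * (k.factorial / c) := by
                refine Finset.sum_congr rfl fun G _ => ?_
                rw [← Finset.mul_sum, ← Finset.mul_sum, hest, mul_one, div_eq_mul_inv,
                  div_eq_mul_inv, mul_assoc, mul_comm c⁻¹]
            _ = _ := by rw [← Finset.sum_mul, sum_sum_jointMass, one_mul]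
        
end Model

/-! ### Concentration of the number of free moves and of community sizes. -/

theorem independentLaw_real_eval {ι α : Type} [Fintype ι] [DecidableEq ι] [Fintype α]
    [MeasurableSpace α] [MeasurableSingletonClass α] (p : ι → PMF α) (i : ι) (A : Set α) :
    (independentLaw p).toMeasure.real {x | x i ∈ A} = (p i).toMeasure.real A := by
  rw [toMeasure_independentLaw, measureReal_def, measureReal_def]
  congr 1
  exact (measurePreserving_eval (fun i => (p i).toMeasure) i).measure_preimage
    A.toFinite.measurableSet.nullMeasurableSet

section Concentration

variable {k : ℕ} (M : Params k) (t : ℝ) {n : ℕ}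

theorem edgeLaw_real_not_censored (a b : Fin k) :
    (edgeLaw M t n a b).toMeasure.real {.censored}ᶜ = revealProb t n := by
  have hq := (revealProb t n).2
  rw [probReal_compl_eq_one_sub (measurableSet_singleton _), measureReal_def,
    PMF.toMeasure_apply_singleton _ _ (measurableSet_singleton _), edgeLaw_apply_censored,
    ENNReal.toReal_ofReal (sub_nonneg.2 hq.2)]
  ring

theorem card_innerPairs_le (s : ℕ) (v : Fin n) : (innerPairs s v).card ≤ s := by
  have h : (innerPairs s v).card ≤ (Finset.range s).card := by
    -- A pair containing `v` is determined by its other endpoint.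
    refine Finset.card_le_card_of_injOn
      (fun e => if e.1.1 = v then e.1.2.val else e.1.1.val) ?_ ?_
    · intro e he
      have h := (Finset.mem_filter.1 he).2
      have hlt : e.1.1.val < e.1.2.val := e.2
      simp only [Finset.coe_range, Set.mem_Iio]
      split_ifs <;> omega
    · intro e he f hf hef
      have h1 := (Finset.mem_filter.1 he).2.2
      have h2 := (Finset.mem_filter.1 hf).2.2
      have he' : e.1.1.val < e.1.2.val := e.2
      have hf' : f.1.1.val < f.1.2.val := f.2
      simp only [Fin.ext_iff] at h1 h2 hef
      refine Subtype.ext (Prod.ext (Fin.ext ?_) (Fin.ext ?_)) <;> split_ifs at hef <;> omega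
  simpa using h

theorem graphLaw_real_innerCensored_ge (s : ℕ) (v : Fin n) (σ : Assignment n k) :
    1 - s * (revealProb t n : ℝ) ≤ (graphLaw M t n σ).toMeasure.real (innerCensored s v) := by
  have hc : (graphLaw M t n σ).toMeasure.real (innerCensored s v)ᶜ ≤ s * (revealProb t n : ℝ) := by
    calc _ ≤ (graphLaw M t n σ).toMeasure.real
          (⋃ e ∈ innerPairs s v, {G : CensoredGraph n | G e ∈ ({.censored}ᶜ : Set EdgeStatus)}) := by
          refine measureReal_mono (fun G hG => ?_) (measure_ne_top _ _)
          simp only [innerCensored, Set.mem_compl_iff, Set.mem_ofPred_eq, not_forall] at hG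
          obtain ⟨e, he, hGe⟩ := hG
          exact Set.mem_biUnion he hGe
      _ ≤ ∑ e ∈ innerPairs s v, (graphLaw M t n σ).toMeasure.real
          {G : CensoredGraph n | G e ∈ ({.censored}ᶜ : Set EdgeStatus)} :=
          measureReal_biUnion_finset_le _ _
      _ = ((innerPairs s v).card : ℝ) * revealProb t n := by
          rw [← nsmul_eq_mul, ← Finset.sum_const]
          refine Finset.sum_congr rfl fun e _ => ?_
          rw [graphLaw_eq, independentLaw_real_eval, edgeLaw_real_not_censored]
      _ ≤ _ := by
          refine mul_le_mul_of_nonneg_right ?_ (revealProb t n).2.1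
          exact_mod_cast card_innerPairs_le s v
  rw [probReal_compl_eq_one_sub (Set.toFinite _).measurableSet] at hc
  linarith

theorem crossFavours_congr {s : ℕ} {σ : Assignment n k} {j : Fin k} {v : Fin n}
    (G H : CensoredGraph n) (h : ∀ e ∈ crossPairs s v, G e = H e)
    (hG : G ∈ crossFavours M t s σ j v) : H ∈ crossFavours M t s σ j v := by
  have h1 : ∀ a : Fin k, ∏ e ∈ crossPairs s v, edgeLaw M t n a (σ e.1.2) (G e) =
      ∏ e ∈ crossPairs s v, edgeLaw M t n a (σ e.1.2) (H e) :=
    fun a => Finset.prod_congr rfl fun e he => by rw [h e he]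
  simp only [crossFavours, Set.mem_ofPred_eq] at hG ⊢
  rwa [← h1, ← h1]

/-- The second moment bound with `ε = s * revealProb t n`, the union bound for an uncensored inner
pair, and deviation `b / 2`, where `b ≥ a` is the sum of the probabilities: `(b + 2 ε b²) / (b / 2)²
= 4 / b + 8 ε`. -/
theorem graphLaw_flipCount_lt_le (s : ℕ) (i j : Fin k) (σ : Assignment n k) {a : ℝ} (ha : 0 < a)
    (hsum : a ≤ ∑ v ∈ initialMembers s σ i,
      (graphLaw M t n σ).toMeasure.real (crossFavours M t s σ j v)) :
    (graphLaw M t n σ).toMeasure.real {G | (flipCount M t s i j σ G : ℝ) < a / 2} ≤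
      4 / a + 8 * (s * (revealProb t n : ℝ)) := by
  set μ := (graphLaw M t n σ).toMeasure with hμ
  set b := ∑ v ∈ initialMembers s σ i, μ.real (crossFavours M t s σ j v) with hb
  have hb0 : 0 < b := ha.trans_le hsum
  have h := measureReal_count_deviation_le μ (initialMembers s σ i)
    (fun v => crossFavours M t s σ j v ∩ innerCensored s v)
    (fun v => crossFavours M t s σ j v) (s * (revealProb t n : ℝ))
    (fun v _ => Set.inter_subset_left) ?_ ?_ (x := b / 2) (by positivity)
  · calc _ ≤ _ := measureReal_mono fun G hG => ?_
      _ ≤ _ := h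
      _ = 4 / b + 8 * (s * (revealProb t n : ℝ)) := by
          rw [← hb]
          field_simp
          ring
      _ ≤ _ := by gcongr
    have hG' : (flipCount M t s i j σ G : ℝ) < a / 2 := hG
    rw [Set.mem_ofPred_eq, ← hb]
    have e : b / 2 ≤ |(flipCount M t s i j σ G : ℝ) - b| := by
      rw [abs_sub_comm]
      exact le_trans (by linarith) (le_abs_self _)
    convert e using 4
    rw [flipCount]
    congr!
  · intro v _ w _ hvw
    rw [hμ, graphLaw_eq]
    refine independentLaw_real_inter _ (S := crossPairs s v) (T := crossPairs s w) ?_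
      (crossFavours_congr M t) (crossFavours_congr M t)
    rw [Finset.disjoint_left]
    intro e he hf
    exact hvw ((Finset.mem_filter.1 he).2.1.symm.trans (Finset.mem_filter.1 hf).2.1)
  · intro v _
    have h1 := graphLaw_real_innerCensored_ge M t s v σ
    have h2 : μ.real (crossFavours M t s σ j v ∩ innerCensored s v) =
        μ.real (crossFavours M t s σ j v) * μ.real (innerCensored s v) := by
      rw [hμ, graphLaw_eq]
      refine independentLaw_real_inter _ (S := crossPairs s v) (T := innerPairs s v) ?_
        (crossFavours_congr M t) fun G H hGH hG e he => by rw [← hGH e he, hG e he]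
      rw [Finset.disjoint_left]
      intro e he hf
      have h3 := (Finset.mem_filter.1 he).2.2
      have h4 := (Finset.mem_filter.1 hf).2.1
      omega
    rw [h2, mul_comm]
    exact mul_le_mul_of_nonneg_left h1 measureReal_nonneg

theorem assignmentLaw_count_deviation_le (T : Finset (Fin n)) (r : Fin k) {x : ℝ} (hx : 0 < x) :
    (assignmentLaw M n).toMeasure.real
        {σ | x ≤ |((T.filter fun v => σ v = r).card : ℝ) - T.card * M.ρ r|} ≤
      T.card / x ^ 2 := by
  classical
  have hp : ∀ v, (assignmentLaw M n).toMeasure.real {σ | σ v = r} = M.ρ r := by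
    intro v
    have h := independentLaw_real_eval (fun _ : Fin n => communityLaw M) v {r}
    rw [measureReal_def (μ := (communityLaw M).toMeasure),
      PMF.toMeasure_apply_singleton _ _ (measurableSet_singleton _)] at h
    refine h.trans (ENNReal.toReal_ofReal (M.ρ_mem r).1.le)
  have h := measureReal_count_deviation_le (assignmentLaw M n).toMeasure T
    (fun v => {σ | σ v = r}) (fun v => {σ | σ v = r}) 0 (fun v _ => le_rfl) ?_
    (fun v _ => by simp) hx
  · simp only [hp, Finset.sum_const, nsmul_eq_mul, Set.mem_ofPred_eq, mul_zero, zero_mul,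
      add_zero] at h
    refine le_trans (le_of_eq ?_) (h.trans ?_)
    · congr!
    · refine div_le_div_of_nonneg_right ?_ (sq_nonneg x)
      exact mul_le_of_le_one_right (Nat.cast_nonneg _) (M.ρ_mem r).2.le
  · intro v _ w _ hvw
    refine independentLaw_real_inter _ (S := {v}) (T := {w}) (by simpa using hvw) ?_ ?_
    · intro x y h hx
      have := h v (by simp)
      simp only [Set.mem_ofPred_eq] at hx ⊢
      rw [← this, hx]
    · intro x y h hx
      have := h w (by simp)
      simp only [Set.mem_ofPred_eq] at hx ⊢
      rw [← this, hx]

end Concentration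

/-! ### Chernoff–Hellinger divergence and the choice of the tilt. -/

section Divergence

/-- Gibbs' inequality: the left side is minus the relative entropy of two Bernoulli laws. -/
theorem bernoulli_mean_log_div_nonpos {a b : ℝ} (ha : a ∈ Set.Ioo (0 : ℝ) 1) (hb : b ∈ Set.Ioo (0 : ℝ) 1) :
    a * Real.log (b / a) + (1 - a) * Real.log ((1 - b) / (1 - a)) ≤ 0 := by
  have ha' : 0 < 1 - a := sub_pos.2 ha.2
  have hb' : 0 < 1 - b := sub_pos.2 hb.2
  have h1 := mul_le_mul_of_nonneg_left (Real.log_le_sub_one_of_pos (div_pos hb.1 ha.1)) ha.1.le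
  have h2 := mul_le_mul_of_nonneg_left (Real.log_le_sub_one_of_pos (div_pos hb' ha')) ha'.le
  rw [mul_sub, mul_div_cancel₀ _ ha.1.ne'] at h1
  rw [mul_sub, mul_div_cancel₀ _ ha'.ne'] at h2
  linarith

theorem bernoulli_mean_log_div_neg {a b : ℝ} (ha : a ∈ Set.Ioo (0 : ℝ) 1) (hb : b ∈ Set.Ioo (0 : ℝ) 1)
    (hab : a ≠ b) : a * Real.log (b / a) + (1 - a) * Real.log ((1 - b) / (1 - a)) < 0 := by
  have ha' : 0 < 1 - a := sub_pos.2 ha.2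
  have hb' : 0 < 1 - b := sub_pos.2 hb.2
  have h1 := mul_lt_mul_of_pos_left (Real.log_lt_sub_one_of_pos (div_pos hb.1 ha.1)
    fun h => hab ((div_eq_one_iff_eq ha.1.ne').1 h).symm) ha.1
  have h2 := mul_le_mul_of_nonneg_left (Real.log_le_sub_one_of_pos (div_pos hb' ha')) ha'.le
  rw [mul_sub, mul_div_cancel₀ _ ha.1.ne'] at h1
  rw [mul_sub, mul_div_cancel₀ _ ha'.ne'] at h2
  linarith

theorem rpow_mul_rpow_eq_mul_exp {a b c : ℝ} (ha : 0 < a) (hb : 0 < b) (hc : 0 < c) (θ : ℝ) :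
    (c * a) ^ (1 - θ) * (c * b) ^ θ = c * (a * Real.exp (θ * Real.log (b / a))) := by
  rw [Real.rpow_def_of_pos (mul_pos hc ha), Real.rpow_def_of_pos (mul_pos hc hb), ← Real.exp_add,
    Real.log_mul hc.ne' ha.ne', Real.log_mul hc.ne' hb.ne', Real.log_div hb.ne' ha.ne']
  have h : c * (a * Real.exp (θ * (Real.log b - Real.log a))) =
      Real.exp (Real.log c + (Real.log a + θ * (Real.log b - Real.log a))) := by
    rw [Real.exp_add, Real.exp_add, Real.exp_log hc, Real.exp_log ha]
  rw [h]
  ring_nf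

variable {k : ℕ} (M : Params k)

/-- The log-likelihood ratio of the communities `j` and `i` of a vertex, given the status of its
pair with a vertex of the community `r`. -/
noncomputable def logRatio (i j r : Fin k) : EdgeStatus → ℝ
  | .present => Real.log (M.P j r / M.P i r)
  | .absent => Real.log ((1 - M.P j r) / (1 - M.P i r))
  | .censored => 0

/-- The expectation of `f` over the status of a revealed pair between the communities `i`, `r`. -/
def revealedMean (i r : Fin k) (f : EdgeStatus → ℝ) : ℝ :=
  M.P i r * f .present + (1 - M.P i r) * f .absent

/-- The exponential moment of the log-likelihood ratio of a revealed pair. -/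
noncomputable def expMoment (i j r : Fin k) (θ : ℝ) : ℝ :=
  revealedMean M i r fun x => Real.exp (θ * logRatio M i j r x)

/-- The derivative of `expMoment` in the parameter `θ`. -/
noncomputable def expMomentDeriv (i j r : Fin k) (θ : ℝ) : ℝ :=
  revealedMean M i r fun x => Real.exp (θ * logRatio M i j r x) * logRatio M i j r x

/-- The second derivative of `expMoment` in the parameter `θ`. -/
noncomputable def expMomentDeriv2 (i j r : Fin k) (θ : ℝ) : ℝ :=
  revealedMean M i r fun x => Real.exp (θ * logRatio M i j r x) * logRatio M i j r x ^ 2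

theorem expMoment_pos (i j r : Fin k) (θ : ℝ) : 0 < expMoment M i j r θ :=
  add_pos (mul_pos (M.P_mem i r).1 (Real.exp_pos _))
    (mul_pos (sub_pos.2 (M.P_mem i r).2) (Real.exp_pos _))

/-- The left side equals `CH_{1-θ}(θ_i, θ_j)`: tilting by `θ` turns the weights `P i r` into `(P i
r)^(1-θ) * (P j r)^θ`. This links the large deviation rate to the threshold. -/
theorem sum_mul_one_sub_expMoment_le {i j : Fin k} {θ : ℝ} (hθ : θ ∈ Set.Icc (0 : ℝ) 1) :
    ∑ r, M.ρ r * (1 - expMoment M i j r θ) ≤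
      chernoffHellinger (profileVector M i) (profileVector M j) := by
  have hpos : ∀ a l, 0 < profileVector M a l := by
    rintro a (r | r)
    · exact mul_pos (M.ρ_mem r).1 (M.P_mem r a).1
    · exact mul_pos (M.ρ_mem r).1 (sub_pos.2 (M.P_mem r a).2)
  have h := (isGreatest_chernoffHellinger (hpos i) (hpos j)).2
    ⟨1 - θ, ⟨sub_nonneg.2 hθ.2, sub_le_self _ hθ.1⟩, rfl⟩
  refine le_trans (le_of_eq ?_) h
  simp only [chernoffHellingerAt, Fintype.sum_sum_type, profileVector, Sum.elim_inl, Sum.elim_inr,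
    sub_sub_cancel]
  rw [← Finset.sum_add_distrib]
  refine Finset.sum_congr rfl fun r _ => ?_
  rw [rpow_mul_rpow_eq_mul_exp (M.P_mem r i).1 (M.P_mem r j).1 (M.ρ_mem r).1,
    rpow_mul_rpow_eq_mul_exp (sub_pos.2 (M.P_mem r i).2) (sub_pos.2 (M.P_mem r j).2)
      (M.ρ_mem r).1]
  simp only [expMoment, revealedMean, logRatio, M.P_symm.apply i r, M.P_symm.apply j r]
  ring

/-- If the communities `i` and `j` are distinguishable, some tilt makes the mean of the
log-likelihood ratio positive, but arbitrarily small. -/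
theorem exists_tilt {i j : Fin k} (h : ∃ r, M.P i r ≠ M.P j r) {δ : ℝ} (hδ : 0 < δ) :
    ∃ θ ∈ Set.Icc (0 : ℝ) 1, 0 < ∑ r, M.ρ r * expMomentDeriv M i j r θ ∧
      ∑ r, M.ρ r * expMomentDeriv M i j r θ ≤ δ := by
  set D : ℝ → ℝ := fun θ => ∑ r, M.ρ r * expMomentDeriv M i j r θ with hD
  have hcont : Continuous D := by
    simp only [hD, expMomentDeriv, revealedMean]
    fun_prop
  have h0 : D 0 ≤ 0 := by
    refine Finset.sum_nonpos fun r _ => mul_nonpos_of_nonneg_of_nonpos (M.ρ_mem r).1.le ?_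
    simpa [expMomentDeriv, revealedMean, logRatio] using
      bernoulli_mean_log_div_nonpos (M.P_mem i r) (M.P_mem j r)
  -- At `θ = 1` the tilt replaces the law of community `i` by that of `j`, so the mean becomes a
  -- relative entropy with the roles exchanged.
  have hone : ∀ r, expMomentDeriv M i j r 1 = -(M.P j r * Real.log (M.P i r / M.P j r) +
      (1 - M.P j r) * Real.log ((1 - M.P i r) / (1 - M.P j r))) := by
    intro r
    have hi := M.P_mem i r
    have hj := M.P_mem j r
    have hi' : 0 < 1 - M.P i r := sub_pos.2 hi.2
    have hj' : 0 < 1 - M.P j r := sub_pos.2 hj.2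
    simp only [expMomentDeriv, revealedMean, logRatio, one_mul]
    rw [Real.exp_log (div_pos hj.1 hi.1), Real.exp_log (div_pos hj' hi'), ← mul_assoc,
      ← mul_assoc, mul_div_cancel₀ _ hi.1.ne', mul_div_cancel₀ _ hi'.ne',
      ← inv_div (M.P j r), ← inv_div (1 - M.P j r), Real.log_inv, Real.log_inv]
    ring
  have h1 : 0 < D 1 := by
    obtain ⟨r, hr⟩ := h
    refine Finset.sum_pos' (fun r _ => mul_nonneg (M.ρ_mem r).1.le ?_)
      ⟨r, Finset.mem_univ r, mul_pos (M.ρ_mem r).1 ?_⟩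
    · rw [hone]
      exact neg_nonneg.2 (bernoulli_mean_log_div_nonpos (M.P_mem j r) (M.P_mem i r))
    · rw [hone]
      exact neg_pos.2 (bernoulli_mean_log_div_neg (M.P_mem j r) (M.P_mem i r) hr.symm)
  have hm : 0 < min δ (D 1) := lt_min hδ h1
  obtain ⟨θ, hθ, hDθ⟩ := intermediate_value_Icc zero_le_one hcont.continuousOn
    (show min δ (D 1) ∈ Set.Icc (D 0) (D 1) from ⟨h0.trans hm.le, min_le_right _ _⟩)
  exact ⟨θ, hθ, hm.trans_eq hDθ.symm, hDθ.trans_le (min_le_left _ _)⟩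

end Divergence

/-! ### Polynomial lower bound for the probability of a favourable vertex. -/

section LowerBound

variable {k : ℕ} (M : Params k) (t : ℝ) {n : ℕ}

/-- The number of vertices of the community `r` outside of the first `s` vertices. -/
def outerCount (s : ℕ) (σ : Assignment n k) (r : Fin k) : ℕ :=
  (Finset.univ.filter fun u : Fin n => s ≤ u.val ∧ σ u = r).card

theorem sum_crossPairs {s : ℕ} {v : Fin n} (hv : v.val < s) (σ : Assignment n k)
    (f : Fin k → ℝ) :
    ∑ e ∈ crossPairs s v, f (σ e.1.2) = ∑ r, (outerCount s σ r : ℝ) * f r := by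
  have h : ∑ e ∈ crossPairs s v, f (σ e.1.2) =
      ∑ u ∈ Finset.univ.filter (fun u : Fin n => s ≤ u.val), f (σ u) := by
    refine Finset.sum_bij (fun e _ => e.1.2) ?_ ?_ ?_ fun _ _ => rfl
    · intro e he
      simpa using (Finset.mem_filter.1 he).2.2
    · intro e he e' he' heq
      have h1 := (Finset.mem_filter.1 he).2.1
      have h2 := (Finset.mem_filter.1 he').2.1
      exact Subtype.ext (Prod.ext (h1.trans h2.symm) heq)
    · intro u hu
      have hu' := (Finset.mem_filter.1 hu).2
      exact ⟨⟨(v, u), Fin.lt_def.2 (hv.trans_le hu')⟩, by simp [crossPairs, hu'], rfl⟩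
  rw [h, ← Finset.sum_fiberwise _ σ]
  refine Finset.sum_congr rfl fun r _ => ?_
  rw [Finset.sum_congr rfl fun u hu => by rw [(Finset.mem_filter.1 hu).2], Finset.sum_const,
    nsmul_eq_mul, Finset.filter_filter, outerCount]

theorem edgeLaw_sum_mul (a b : Fin k) (f : EdgeStatus → ℝ) :
    ∑ x, (edgeLaw M t n a b x).toReal * f x =
      revealProb t n * revealedMean M a b f + (1 - revealProb t n) * f .censored := by
  have hq := (revealProb t n).2
  have hp := M.P_mem a b
  have hu : (Finset.univ : Finset EdgeStatus) = {.present, .absent, .censored} := rfl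
  have h1 : (edgeLaw M t n a b .present).toReal = revealProb t n * M.P a b :=
    ENNReal.toReal_ofReal (mul_nonneg hq.1 hp.1.le)
  have h2 : (edgeLaw M t n a b .absent).toReal = revealProb t n * (1 - M.P a b) :=
    ENNReal.toReal_ofReal (mul_nonneg hq.1 (sub_nonneg.2 hp.2.le))
  have h3 : (edgeLaw M t n a b .censored).toReal = 1 - revealProb t n :=
    ENNReal.toReal_ofReal (sub_nonneg.2 hq.2)
  rw [hu, Finset.sum_insert (by decide), Finset.sum_insert (by decide), Finset.sum_singleton,
    h1, h2, h3, revealedMean]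
  ring

theorem edgeLaw_eq_mul_exp (i j r : Fin k) (x : EdgeStatus) :
    edgeLaw M t n j r x =
      edgeLaw M t n i r x * ENNReal.ofReal (Real.exp (logRatio M i j r x)) := by
  have hq := (revealProb t n).2
  have hi := M.P_mem i r
  have hj := M.P_mem j r
  have hi' : 0 < 1 - M.P i r := sub_pos.2 hi.2
  have hj' : 0 < 1 - M.P j r := sub_pos.2 hj.2
  cases x with
  | present =>
    change ENNReal.ofReal (revealProb t n * M.P j r) = ENNReal.ofReal (revealProb t n * M.P i r) *
      ENNReal.ofReal (Real.exp (Real.log (M.P j r / M.P i r)))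
    rw [← ENNReal.ofReal_mul (mul_nonneg hq.1 hi.1.le), Real.exp_log (div_pos hj.1 hi.1),
      mul_assoc, mul_div_cancel₀ _ hi.1.ne']
  | absent =>
    change ENNReal.ofReal (revealProb t n * (1 - M.P j r)) =
      ENNReal.ofReal (revealProb t n * (1 - M.P i r)) *
        ENNReal.ofReal (Real.exp (Real.log ((1 - M.P j r) / (1 - M.P i r))))
    rw [← ENNReal.ofReal_mul (mul_nonneg hq.1 hi'.le), Real.exp_log (div_pos hj' hi'),
      mul_assoc, mul_div_cancel₀ _ hi'.ne']
  | censored => simp [edgeLaw_apply_censored, logRatio]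

theorem mem_crossFavours_of_sum_nonneg {s : ℕ} {σ : Assignment n k} {i j : Fin k} {v : Fin n}
    (hσ : σ v = i) {G : CensoredGraph n}
    (h : 0 ≤ ∑ e ∈ crossPairs s v, logRatio M i j (σ e.1.2) (G e)) :
    G ∈ crossFavours M t s σ j v := by
  simp only [crossFavours, Set.mem_ofPred_eq, hσ]
  rw [Finset.prod_congr rfl fun e _ => edgeLaw_eq_mul_exp M t i j (σ e.1.2) (G e),
    Finset.prod_mul_distrib, ← ENNReal.ofReal_prod_of_nonneg fun e _ => (Real.exp_pos _).le,
    ← Real.exp_sum]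
  exact le_mul_of_one_le_right' (ENNReal.one_le_ofReal.2 (Real.one_le_exp h))

/-- The normalization of the tilted law of the status of a pair. -/
noncomputable def tiltNorm (q : ℝ) (i j r : Fin k) (θ : ℝ) : ℝ :=
  q * expMoment M i j r θ + (1 - q)

theorem tiltNorm_pos {q : ℝ} (hq : q ∈ Set.Icc (0 : ℝ) 1) (i j r : Fin k) (θ : ℝ) :
    0 < tiltNorm M q i j r θ := by
  have h := expMoment_pos M i j r θ
  rcases hq.1.eq_or_lt with h0 | h0
  · simp [tiltNorm, ← h0]
  · exact add_pos_of_pos_of_nonneg (mul_pos h0 h) (sub_nonneg.2 hq.2)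

/-- The tilting bound for the pairs of `v` with outer vertices, grouped by community: `F₁` is the
tilted mean, `F₂` a bound on the variance, and `exp (-F₀)` a lower bound for the normalizing
product. -/
theorem exp_le_graphLaw_real_crossFavours {s : ℕ} {σ : Assignment n k} {i j : Fin k} {v : Fin n}
    (hv : v.val < s) (hσ : σ v = i) {θ : ℝ} (hθ : θ ∈ Set.Icc (0 : ℝ) 1) {q F₀ F₁ F₂ : ℝ}
    (hq : q = revealProb t n)
    (h₀ : F₀ = ∑ r, (outerCount s σ r : ℝ) *
      (q * (1 - expMoment M i j r θ) / tiltNorm M q i j r θ))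
    (h₁ : F₁ = ∑ r, (outerCount s σ r : ℝ) *
      (q * expMomentDeriv M i j r θ / tiltNorm M q i j r θ))
    (h₂ : F₂ = ∑ r, (outerCount s σ r : ℝ) *
      (q * expMomentDeriv2 M i j r θ / tiltNorm M q i j r θ))
    (hF₁ : 0 < F₁) (hF₂ : F₂ ≤ F₁ ^ 2) :
    Real.exp (-F₀) * Real.exp (-(2 * F₁)) * (1 - F₂ / F₁ ^ 2) ≤
      (graphLaw M t n σ).toMeasure.real (crossFavours M t s σ j v) := by
  have hq01 : q ∈ Set.Icc (0 : ℝ) 1 := hq ▸ (revealProb t n).2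
  -- Extended by zero, so that the remaining pairs are not tilted and contribute the factor `1`.
  set l : VertexPair n → EdgeStatus → ℝ := fun e x =>
    if e ∈ crossPairs s v then logRatio M i j (σ e.1.2) x else 0 with hl
  have hpair : ∀ e ∈ crossPairs s v, σ e.1.1 = i := fun e he => by
    rw [(Finset.mem_filter.1 he).2.1, hσ]
  have hsum : ∀ e, ∑ x, (edgeLaw M t n (σ e.1.1) (σ e.1.2) x).toReal * Real.exp (θ * l e x) =
      if e ∈ crossPairs s v then tiltNorm M q i j (σ e.1.2) θ else 1 := by
    intro e
    rw [edgeLaw_sum_mul, ← hq]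
    split_ifs with he
    · simp only [hl, he, if_true, hpair e he, tiltNorm, expMoment]
      simp [logRatio]
    · simp only [hl, he, if_false, revealedMean, mul_zero, Real.exp_zero]
      ring
  have hsum1 : ∀ e, ∑ x, (edgeLaw M t n (σ e.1.1) (σ e.1.2) x).toReal * Real.exp (θ * l e x) *
      l e x = if e ∈ crossPairs s v then q * expMomentDeriv M i j (σ e.1.2) θ else 0 := by
    intro e
    simp only [mul_assoc]
    rw [edgeLaw_sum_mul, ← hq]
    split_ifs with he
    · simp only [hl, he, if_true, hpair e he, expMomentDeriv]
      simp [logRatio]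
    · simp only [hl, he, if_false, revealedMean]
      ring
  have hsum2 : ∀ e, ∑ x, (edgeLaw M t n (σ e.1.1) (σ e.1.2) x).toReal * Real.exp (θ * l e x) *
      l e x ^ 2 = if e ∈ crossPairs s v then q * expMomentDeriv2 M i j (σ e.1.2) θ else 0 := by
    intro e
    simp only [mul_assoc]
    rw [edgeLaw_sum_mul, ← hq]
    split_ifs with he
    · simp only [hl, he, if_true, hpair e he, expMomentDeriv2]
      simp [logRatio]
    · simp only [hl, he, if_false, revealedMean]
      ring
  have hite : ∀ f : Fin k → ℝ, (∑ e : VertexPair n, (if e ∈ crossPairs s v then q * f (σ e.1.2)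
      else 0) / (if e ∈ crossPairs s v then tiltNorm M q i j (σ e.1.2) θ else 1)) =
      ∑ r, (outerCount s σ r : ℝ) * (q * f r / tiltNorm M q i j r θ) := by
    intro f
    rw [← sum_crossPairs hv σ fun r => q * f r / tiltNorm M q i j r θ,
      ← Finset.sum_filter_add_sum_filter_not Finset.univ (· ∈ crossPairs s v),
      Finset.filter_univ_mem]
    rw [Finset.sum_eq_zero (s := Finset.univ.filter (· ∉ crossPairs s v)), add_zero]
    · exact Finset.sum_congr rfl fun e he => by simp [he]
    · intro e he
      simp [(Finset.mem_filter.1 he).2]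
  have h := le_independentLaw_real_sum_nonneg
    (fun e => edgeLaw M t n (σ e.1.1) (σ e.1.2)) l (m := F₁) (V := F₂) hθ hF₁
    (by simp only [hsum, hsum1]; rw [h₁]; exact hite fun r => expMomentDeriv M i j r θ)
    (by simp only [hsum, hsum2]; rw [h₂]; exact (hite fun r => expMomentDeriv2 M i j r θ).le)
  rw [← graphLaw_eq] at h
  simp only [hsum] at h
  refine le_trans ?_ (h.trans (measureReal_mono fun G hG => ?_))
  · refine mul_le_mul_of_nonneg_right (mul_le_mul_of_nonneg_right ?_ (Real.exp_pos _).le)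
      (sub_nonneg.2 (div_le_one_of_le₀ hF₂ (sq_nonneg _)))
    rw [Finset.prod_ite, Finset.prod_const_one, mul_one, Finset.filter_univ_mem, h₀,
      ← sum_crossPairs hv σ fun r => q * (1 - expMoment M i j r θ) / tiltNorm M q i j r θ,
      ← Finset.sum_neg_distrib, Real.exp_sum]
    refine Finset.prod_le_prod (fun _ _ => (Real.exp_pos _).le) fun e _ => ?_
    have hZ := tiltNorm_pos M hq01 i j (σ e.1.2) θ
    rw [← Real.le_log_iff_exp_le hZ]
    -- For the normalization `Z`, `log Z ≥ 1 - 1 / Z = -q (1 - expMoment) / Z`, which is why `F₀`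
    -- carries `tiltNorm` in its denominator.
    refine le_trans (le_of_eq ?_) (Real.one_sub_inv_le_log_of_pos hZ)
    field_simp
    simp only [tiltNorm]
    ring
  · refine mem_crossFavours_of_sum_nonneg M t hσ ?_
    have hG' : 0 ≤ ∑ e, l e (G e) := hG
    rwa [hl, ← Finset.sum_filter, Finset.filter_univ_mem] at hG'

theorem tendsto_mul_log_div (t : ℝ) :
    Tendsto (fun n : ℕ => t * Real.log n / n) atTop (𝓝 0) := by
  have h := (Real.isLittleO_log_id_atTop.tendsto_div_nhds_zero).comp tendsto_natCast_atTop_atTop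
  have h' := h.const_mul t
  rw [mul_zero] at h'
  refine h'.congr fun n => ?_
  simp [mul_div_assoc]

variable {t}

theorem eventually_revealProb_eq (ht : 0 < t) :
    ∀ᶠ n : ℕ in atTop, (revealProb t n : ℝ) = t * Real.log n / n := by
  filter_upwards [(tendsto_mul_log_div t).eventually_le_const zero_lt_one] with n hn
  rw [revealProb, Set.projIcc_of_mem zero_le_one]
  exact ⟨div_nonneg (mul_nonneg ht.le (Real.log_natCast_nonneg n)) (Nat.cast_nonneg n), hn⟩

/-- Divided by `t log n`, the sums `F₀, F₁, F₂` are continuous in the empirical community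
proportions and `q` near `(ρ, 0)`. One radius `η` therefore serves all `s`, `σ` and `v`. The cost is
`C + δ` from `F₀` and `4 δ` from `2 F₁`, hence the factor `5`. -/
theorem exists_le_graphLaw_real_crossFavours_of_tilt (ht : 0 < t) {i j : Fin k} {θ : ℝ}
    (hθ : θ ∈ Set.Icc (0 : ℝ) 1) (hδ : 0 < ∑ r, M.ρ r * expMomentDeriv M i j r θ) {γ : ℝ}
    (hγ : t * (∑ r, M.ρ r * (1 - expMoment M i j r θ) +
      5 * ∑ r, M.ρ r * expMomentDeriv M i j r θ) < γ) :
    ∃ η > 0, ∀ᶠ n : ℕ in atTop, ∀ (s : ℕ) (σ : Assignment n k) (v : Fin n), v.val < s → σ v = i →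
      (∀ r, |(outerCount s σ r : ℝ) / n - M.ρ r| ≤ η) →
      (n : ℝ) ^ (-γ) ≤ (graphLaw M t n σ).toMeasure.real (crossFavours M t s σ j v) := by
  set C := ∑ r, M.ρ r * (1 - expMoment M i j r θ) with hC
  set δ := ∑ r, M.ρ r * expMomentDeriv M i j r θ with hδ'
  set K := ∑ r, M.ρ r * expMomentDeriv2 M i j r θ with hK
  set f : (Fin k → ℝ) → ((Fin k → ℝ) × ℝ) → ℝ :=
    fun a y => ∑ r, y.1 r * (a r / tiltNorm M y.2 i j r θ) with hf
  have hlim : ∀ a : Fin k → ℝ, Tendsto (f a) (𝓝 (M.ρ, 0)) (𝓝 (∑ r, M.ρ r * a r)) := by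
    intro a
    have hc : ContinuousAt (f a) (M.ρ, 0) := by
      refine tendsto_finsetSum _ fun r _ => ?_
      refine Tendsto.mul (Continuous.tendsto (by fun_prop) _)
        (Tendsto.div tendsto_const_nhds (Continuous.tendsto ?_ _) ?_)
      · simp only [tiltNorm]
        fun_prop
      · simp [tiltNorm]
    have := hc.tendsto
    simpa [hf, tiltNorm] using this
  have hev : ∀ᶠ y in 𝓝 (M.ρ, (0 : ℝ)),
      f (fun r => 1 - expMoment M i j r θ) y ≤ C + δ ∧
      (δ / 2 ≤ f (fun r => expMomentDeriv M i j r θ) y ∧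
        f (fun r => expMomentDeriv M i j r θ) y ≤ 2 * δ) ∧
      f (fun r => expMomentDeriv2 M i j r θ) y ≤ K + 1 := by
    refine ((hlim _).eventually_le_const (by linarith)).and
      ((((hlim _).eventually_const_le (by linarith)).and
        ((hlim _).eventually_le_const (by linarith))).and
        ((hlim _).eventually_le_const (by linarith)))
  obtain ⟨ε, hε, hball⟩ := Metric.eventually_nhds_iff.1 hev
  have hΛ : Tendsto (fun n : ℕ => t * Real.log n) atTop atTop :=
    (Real.tendsto_log_atTop.comp tendsto_natCast_atTop_atTop).const_mul_atTop ht
  have hsmall : Tendsto (fun n : ℕ => (γ - t * (C + 5 * δ)) * Real.log n) atTop atTop :=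
    (Real.tendsto_log_atTop.comp tendsto_natCast_atTop_atTop).const_mul_atTop (sub_pos.2 hγ)
  refine ⟨ε / 2, half_pos hε, ?_⟩
  -- Since `f2 ≤ K + 1` and `f1 ≥ δ / 2`, the bound `8 (K + 1) / δ²` on `Λ` makes the Chebyshev
  -- factor at least `1/2`; the slack of size `log 2` in the exponent absorbs that factor.
  filter_upwards [eventually_revealProb_eq ht, (tendsto_mul_log_div t).eventually_lt_const hε,
    hΛ.eventually_gt_atTop 0, hΛ.eventually_ge_atTop (8 * (K + 1) / δ ^ 2),
    hsmall.eventually_ge_atTop (Real.log 2), eventually_gt_atTop 0]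
    with n hqn hqε hΛ0 hΛK hn2 hn0 s σ v hv hσ hcount
  have hn : (0 : ℝ) < n := Nat.cast_pos.2 hn0
  set Λ := t * Real.log n with hΛdef
  set q := Λ / n with hq
  have hq0 : 0 ≤ q := (div_pos hΛ0 hn).le
  set y : (Fin k → ℝ) × ℝ := (fun r => (outerCount s σ r : ℝ) / n, q) with hy
  have hdist : dist y (M.ρ, 0) < ε := by
    rw [Prod.dist_eq, max_lt_iff, dist_pi_lt_iff hε]
    refine ⟨fun r => ?_, ?_⟩
    · rw [Real.dist_eq]
      exact (hcount r).trans_lt (half_lt_self hε)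
    · rw [Real.dist_eq, sub_zero, abs_of_nonneg hq0]
      exact hqε
  obtain ⟨b0, ⟨b1, b1'⟩, b2⟩ := hball hdist
  have hF : ∀ a : Fin k → ℝ, Λ * f a y =
      ∑ r, (outerCount s σ r : ℝ) * (q * a r / tiltNorm M q i j r θ) := by
    intro a
    simp only [hf, hy, hq, Finset.mul_sum]
    refine Finset.sum_congr rfl fun r _ => ?_
    ring
  set f0 := f (fun r => 1 - expMoment M i j r θ) y
  set f1 := f (fun r => expMomentDeriv M i j r θ) y
  set f2 := f (fun r => expMomentDeriv2 M i j r θ) y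
  have hf1 : 0 < f1 := (half_pos hδ).trans_le b1
  have hF1 : 0 < Λ * f1 := mul_pos hΛ0 hf1
  have hV : 2 * (Λ * f2) ≤ (Λ * f1) ^ 2 := by
    have h1 : 8 * (K + 1) ≤ Λ * δ ^ 2 := (div_le_iff₀ (by positivity)).1 hΛK
    have h2 : δ ^ 2 ≤ 4 * f1 ^ 2 := by nlinarith
    have h3 : 2 * f2 ≤ Λ * f1 ^ 2 := by nlinarith
    nlinarith
  have hV' : Λ * f2 ≤ (Λ * f1) ^ 2 := by nlinarith [sq_nonneg (Λ * f1)]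
  refine le_trans ?_ (exp_le_graphLaw_real_crossFavours M t hv hσ hθ
    (q := q) (F₀ := Λ * f0) (F₁ := Λ * f1) (F₂ := Λ * f2) hqn.symm (hF _) (hF _) (hF _) hF1 hV')
  have hhalf : (1 : ℝ) / 2 ≤ 1 - Λ * f2 / (Λ * f1) ^ 2 := by
    have : Λ * f2 / (Λ * f1) ^ 2 ≤ 1 / 2 := by
      rw [div_le_iff₀ (by positivity)]
      linarith
    linarith
  calc (n : ℝ) ^ (-γ) = Real.exp (Real.log n * -γ) := Real.rpow_def_of_pos hn _
    _ ≤ Real.exp (-(Λ * (C + δ)) + -(2 * (Λ * (2 * δ))) + -Real.log 2) := by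
        refine Real.exp_le_exp.2 ?_
        rw [hΛdef]
        linarith
    _ = Real.exp (-(Λ * (C + δ))) * Real.exp (-(2 * (Λ * (2 * δ)))) * (1 / 2) := by
        rw [Real.exp_add, Real.exp_add, Real.exp_neg (Real.log 2), Real.exp_log two_pos, one_div]
    _ ≤ _ := by gcongr

/-- A vertex of the community `i` looks like a vertex of the community `j` with a probability
that is at least a power of `n` with exponent above `-1`. -/
theorem exists_le_graphLaw_real_crossFavours (ht : 0 < t) {i j : Fin k}
    (hij : t * chernoffHellinger (profileVector M i) (profileVector M j) < 1) :
    ∃ γ < (1 : ℝ), ∃ η > 0, ∀ᶠ n : ℕ in atTop, ∀ (s : ℕ) (σ : Assignment n k) (v : Fin n),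
      v.val < s → σ v = i → (∀ r, |(outerCount s σ r : ℝ) / n - M.ρ r| ≤ η) →
      (n : ℝ) ^ (-γ) ≤ (graphLaw M t n σ).toMeasure.real (crossFavours M t s σ j v) := by
  by_cases h : ∃ r, M.P i r ≠ M.P j r
  · set Δ := chernoffHellinger (profileVector M i) (profileVector M j) with hΔ
    -- This `δ` makes the excess `5 t δ` at most a quarter of the gap `1 - t Δ`, while `γ` lies
    -- halfway between `t Δ` and `1`.
    obtain ⟨θ, hθ, h0, h1⟩ := exists_tilt M h
      (δ := (1 - t * Δ) / (20 * t)) (div_pos (sub_pos.2 hij) (by positivity))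
    refine ⟨(1 + t * Δ) / 2, by linarith,
      exists_le_graphLaw_real_crossFavours_of_tilt M ht hθ h0 ?_⟩
    have h2 := sum_mul_one_sub_expMoment_le M (i := i) (j := j) hθ
    rw [le_div_iff₀ (by positivity)] at h1
    have h3 := mul_le_mul_of_nonneg_left h2 ht.le
    rw [← hΔ] at h3
    linarith
  · push Not at h
    -- With equal rows of `P` all log-likelihood ratios vanish, no tilt makes the mean positive, and
    -- the event is certain.
    refine ⟨0, zero_lt_one, 1, zero_lt_one, Eventually.of_forall fun n s σ v hv hσ _ => ?_⟩
    have huniv : crossFavours M t s σ j v = Set.univ := by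
      refine Set.eq_univ_of_forall fun G => mem_crossFavours_of_sum_nonneg M t hσ ?_
      refine Finset.sum_nonneg fun e _ => ?_
      have hi := M.P_mem i (σ e.1.2)
      cases G e <;> simp [logRatio, ← h, div_self hi.1.ne', div_self (sub_pos.2 hi.2).ne']
    rw [huniv, probReal_univ, neg_zero, Real.rpow_zero]

end LowerBound

/-! ### Typical assignments, the scale `⌊n^β⌋`, and the limit. -/

theorem exists_mul_chernoffHellinger_lt_one {k : ℕ} (M : Params k) {t : ℝ} (ht : 0 < t)
    (htc : ENNReal.ofReal t < criticalTime M) :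
    ∃ i j : Fin k, i ≠ j ∧
      t * chernoffHellinger (profileVector M i) (profileVector M j) < 1 := by
  rw [criticalTime, ENNReal.lt_inv_iff_lt_inv] at htc
  simp only [iInf_lt_iff] at htc
  obtain ⟨i, j, hij, h⟩ := htc
  refine ⟨i, j, hij, ?_⟩
  rw [← ENNReal.ofReal_inv_of_pos ht, ENNReal.ofReal_lt_ofReal_iff (inv_pos.2 ht)] at h
  rwa [← lt_div_iff₀' ht, one_div]

section Assembly

variable {k : ℕ} (M : Params k) {t : ℝ} {n : ℕ}

/-- The assignments whose communities have nearly the expected sizes. -/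
def balanced (n s : ℕ) (i : Fin k) (η : ℝ) : Set (Assignment n k) :=
  {σ | (∀ r, |(outerCount s σ r : ℝ) / n - M.ρ r| ≤ η) ∧
    M.ρ i * s / 2 ≤ (initialMembers s σ i).card}

theorem card_filter_val_lt {s : ℕ} (hs : s ≤ n) :
    (Finset.univ.filter fun u : Fin n => u.val < s).card = s := by
  rw [Fin.card_filter_val_lt, min_eq_right hs]

theorem card_filter_le_val {s : ℕ} (hs : s ≤ n) :
    (Finset.univ.filter fun u : Fin n => s ≤ u.val).card = n - s := by
  have h := Finset.card_filter_add_card_filter_not (s := (Finset.univ : Finset (Fin n)))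
    (fun u : Fin n => u.val < s)
  simp only [not_lt, card_filter_val_lt hs, Finset.card_univ, Fintype.card_fin] at h
  omega

theorem assignmentLaw_real_compl_balanced_le {s : ℕ} (hs : 0 < s) (hsn : s ≤ n) (i : Fin k)
    {η : ℝ} (hη : 0 < η) (hsη : (s : ℝ) / n ≤ η / 2) :
    (assignmentLaw M n).toMeasure.real (balanced M n s i η)ᶜ ≤
      4 * k / η ^ 2 / n + 4 / M.ρ i ^ 2 / s := by
  have hs' : (0 : ℝ) < s := Nat.cast_pos.2 hs
  have hn' : (0 : ℝ) < n := Nat.cast_pos.2 (hs.trans_le hsn)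
  have hρ := (M.ρ_mem i).1
  set A : Fin k → Set (Assignment n k) := fun r =>
    {σ | η * n / 2 ≤ |(((Finset.univ.filter fun u : Fin n => s ≤ u.val).filter
      fun u => σ u = r).card : ℝ) - (Finset.univ.filter fun u : Fin n => s ≤ u.val).card * M.ρ r|}
    with hA
  set B : Set (Assignment n k) :=
    {σ | M.ρ i * s / 2 ≤ |(((Finset.univ.filter fun u : Fin n => u.val < s).filter
      fun u => σ u = i).card : ℝ) - (Finset.univ.filter fun u : Fin n => u.val < s).card * M.ρ i|}
    with hB
  have hsub : (balanced M n s i η)ᶜ ⊆ (⋃ r, A r) ∪ B := by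
    intro σ hσ
    by_contra hc
    simp only [hA, hB, Set.mem_union, Set.mem_iUnion, Set.mem_ofPred_eq, not_or, not_exists,
      not_le, Finset.filter_filter, card_filter_val_lt hsn, card_filter_le_val hsn,
      Nat.cast_sub hsn] at hc
    refine hσ ⟨fun r => ?_, ?_⟩
    -- Half of `η` covers the random fluctuation, the other half the `s` vertices left out of
    -- `outerCount`.
    · have h := abs_lt.1 (hc.1 r)
      have hr := M.ρ_mem r
      have h1 := (div_le_iff₀ hn').1 hsη
      have h2 : (s : ℝ) * M.ρ r ≤ s := mul_le_of_le_one_right hs'.le hr.2.le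
      have h3 : 0 ≤ (s : ℝ) * M.ρ r := mul_nonneg hs'.le hr.1.le
      have e : (outerCount s σ r : ℝ) / n - M.ρ r = (outerCount s σ r - n * M.ρ r) / n := by
        field_simp
      have h4 : |(outerCount s σ r : ℝ) - n * M.ρ r| ≤ η * n := by
        rw [outerCount, abs_le]
        constructor <;> linarith [h.1, h.2]
      rw [e, abs_div, abs_of_pos hn']
      exact (div_le_iff₀ hn').2 h4
    · have h := (abs_lt.1 hc.2).1
      rw [initialMembers]
      linarith
  have hAr : ∀ r, (assignmentLaw M n).toMeasure.real (A r) ≤ 4 / η ^ 2 / n := by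
    intro r
    refine (assignmentLaw_count_deviation_le M _ r (by positivity)).trans ?_
    rw [card_filter_le_val hsn]
    calc ((n - s : ℕ) : ℝ) / (η * n / 2) ^ 2 ≤ n / (η * n / 2) ^ 2 := by
          gcongr
          exact Nat.sub_le _ _
      _ = _ := by field_simp; norm_num
  have hBr : (assignmentLaw M n).toMeasure.real B ≤ 4 / M.ρ i ^ 2 / s := by
    refine (assignmentLaw_count_deviation_le M _ i (by positivity)).trans (le_of_eq ?_)
    rw [card_filter_val_lt hsn]
    field_simp
    norm_num
  calc _ ≤ _ := measureReal_mono hsub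
    _ ≤ _ := measureReal_union_le _ _
    _ ≤ (∑ _r : Fin k, 4 / η ^ 2 / n) + 4 / M.ρ i ^ 2 / s :=
        add_le_add ((measureReal_iUnion_fintype_le _).trans (Finset.sum_le_sum fun r _ => hAr r))
          hBr
    _ = _ := by
        rw [Finset.sum_const, Finset.card_univ, Fintype.card_fin, nsmul_eq_mul]
        ring

theorem recoveryProb_le_ofReal {s : ℕ} (hs : 0 < s) (hsn : s ≤ n) {i j : Fin k} (hij : i ≠ j)
    {η b : ℝ} (hη : 0 < η) (hsη : (s : ℝ) / n ≤ η / 2) (hb : 0 < b)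
    (hD : ∀ (σ : Assignment n k) (v : Fin n), v.val < s → σ v = i →
      (∀ r, |(outerCount s σ r : ℝ) / n - M.ρ r| ≤ η) →
      b ≤ (graphLaw M t n σ).toMeasure.real (crossFavours M t s σ j v))
    (est : Estimator n k) :
    recoveryProb M t n est ≤ ENNReal.ofReal
      ((4 * k / η ^ 2 / n + 4 / M.ρ i ^ 2 / s) +
        (8 / M.ρ i / (s * b) + 8 * (s * (revealProb t n : ℝ))) +
        4 * k.factorial / (M.ρ i * M.ρ j) / (s * b)) := by
  classical
  have hs' : (0 : ℝ) < s := Nat.cast_pos.2 hs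
  have hρ := (M.ρ_mem i).1
  have hρj := (M.ρ_mem j).1
  have hq := (revealProb t n).2.1
  -- On a balanced assignment at least `ρ i * s / 2` initial vertices lie in community `i`, each
  -- favourable with probability at least `b`. The posterior bound is applied with threshold `a /
  -- 2`.
  set a := M.ρ i * s / 2 * b with ha
  have ha0 : 0 < a := by positivity
  set c := 8 / M.ρ i / (s * b) + 8 * (s * (revealProb t n : ℝ)) with hc
  have hc0 : 0 ≤ c := by positivity
  have hgood : ∀ σ ∈ balanced M n s i η,
      (graphLaw M t n σ).toMeasure {G | (flipCount M t s i j σ G : ℝ) < a / 2} ≤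
        ENNReal.ofReal c := by
    intro σ hσ
    refine (ENNReal.le_ofReal_iff_toReal_le (measure_ne_top _ _) hc0).2 ?_
    refine (graphLaw_flipCount_lt_le M t s i j σ ha0 ?_).trans (le_of_eq ?_)
    · calc a ≤ ((initialMembers s σ i).card : ℝ) * b := mul_le_mul_of_nonneg_right hσ.2 hb.le
        _ = ∑ v ∈ initialMembers s σ i, b := by rw [Finset.sum_const, nsmul_eq_mul]
        _ ≤ _ := Finset.sum_le_sum fun v hv => by
            obtain ⟨h1, h2⟩ := (Finset.mem_filter.1 hv).2
            exact hD σ v h1 h2 hσ.1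
    · rw [hc, ha]
      congr 1
      field_simp
      norm_num
  have hsum : ∑ σ, assignmentLaw M n σ *
      (graphLaw M t n σ).toMeasure {G | (flipCount M t s i j σ G : ℝ) < a / 2} ≤
      (assignmentLaw M n).toMeasure (balanced M n s i η)ᶜ + ENNReal.ofReal c := by
    calc _ ≤ ∑ σ, ((balanced M n s i η)ᶜ.indicator (assignmentLaw M n) σ +
          assignmentLaw M n σ * ENNReal.ofReal c) := by
          refine Finset.sum_le_sum fun σ _ => ?_
          by_cases hσ : σ ∈ balanced M n s i η
          · exact le_trans (mul_le_mul' le_rfl (hgood σ hσ)) le_add_self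
          · rw [Set.indicator_of_mem hσ]
            exact le_trans (mul_le_of_le_one_right' prob_le_one) le_self_add
      _ = _ := by
          rw [Finset.sum_add_distrib, ← Finset.sum_mul, PMF.toMeasure_apply_fintype,
            ← tsum_fintype (L := .unconditional _) (assignmentLaw M n), PMF.tsum_coe, one_mul]
  have hbal : (assignmentLaw M n).toMeasure (balanced M n s i η)ᶜ ≤
      ENNReal.ofReal (4 * k / η ^ 2 / n + 4 / M.ρ i ^ 2 / s) :=
    (ENNReal.le_ofReal_iff_toReal_le (measure_ne_top _ _) (by positivity)).2
      (assignmentLaw_real_compl_balanced_le M hs hsn i hη hsη)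
  refine (recoveryProb_le M t s hij (half_pos ha0) est).trans ?_
  rw [ENNReal.ofReal_add (by positivity) (by positivity),
    ENNReal.ofReal_add (by positivity) hc0]
  refine add_le_add (hsum.trans (add_le_add hbal le_rfl)) (le_of_eq ?_)
  rw [← ENNReal.ofReal_natCast, ← ENNReal.ofReal_div_of_pos (by positivity), ha]
  congr 1
  field_simp
  norm_num

theorem tendsto_floor_rpow_div {β : ℝ} (hβ : β < 1) :
    Tendsto (fun n : ℕ => (⌊(n : ℝ) ^ β⌋₊ : ℝ) / n) atTop (𝓝 0) := by
  have h := (tendsto_rpow_neg_atTop (sub_pos.2 hβ)).comp tendsto_natCast_atTop_atTop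
  refine tendsto_of_tendsto_of_tendsto_of_le_of_le' tendsto_const_nhds h
    (Eventually.of_forall fun n => by positivity) ?_
  filter_upwards [eventually_gt_atTop 0] with n hn
  have hn' : (0 : ℝ) < n := Nat.cast_pos.2 hn
  have h1 : (n : ℝ) ^ (-(1 - β)) = (n : ℝ) ^ β / n := by
    rw [neg_sub, Real.rpow_sub_one hn'.ne']
  rw [Function.comp_apply, h1]
  gcongr
  exact Nat.floor_le (by positivity)

theorem tendsto_floor_rpow_mul_log_div (t : ℝ) {β : ℝ} (hβ : β < 1) :
    Tendsto (fun n : ℕ => (⌊(n : ℝ) ^ β⌋₊ : ℝ) * (t * Real.log n / n)) atTop (𝓝 0) := by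
  have h := ((isLittleO_log_rpow_atTop (sub_pos.2 hβ)).tendsto_div_nhds_zero.comp
    tendsto_natCast_atTop_atTop).const_mul |t|
  rw [mul_zero] at h
  refine squeeze_zero_norm' ?_ h
  filter_upwards [eventually_gt_atTop 0] with n hn
  have hn' : (0 : ℝ) < n := Nat.cast_pos.2 hn
  have hl := Real.log_natCast_nonneg n
  have h1 : (n : ℝ) ^ (1 - β) = n / (n : ℝ) ^ β := by rw [Real.rpow_sub hn', Real.rpow_one]
  rw [norm_mul, norm_div, norm_mul, Real.norm_eq_abs, Real.norm_eq_abs, Real.norm_eq_abs,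
    Real.norm_eq_abs, abs_of_nonneg hl, abs_of_pos hn', Nat.abs_cast, Function.comp_apply, h1]
  calc _ ≤ (n : ℝ) ^ β * (|t| * Real.log n / n) := by
        gcongr
        exact Nat.floor_le (by positivity)
    _ = _ := by field_simp

theorem tendsto_floor_rpow_mul_rpow {β γ : ℝ} (hβ : 0 < β) (hγ : γ < β) :
    Tendsto (fun n : ℕ => (⌊(n : ℝ) ^ β⌋₊ : ℝ) * (n : ℝ) ^ (-γ)) atTop atTop := by
  have h := ((tendsto_rpow_atTop (sub_pos.2 hγ)).comp
    tendsto_natCast_atTop_atTop).atTop_div_const (two_pos (α := ℝ))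
  refine tendsto_atTop_mono' _ ?_ h
  have h2 := (tendsto_rpow_atTop hβ).comp tendsto_natCast_atTop_atTop
  -- Once `n^β ≥ 2`, rounding down loses at most half.
  filter_upwards [h2.eventually_ge_atTop 2, eventually_gt_atTop 0] with n hn hn0
  have hn' : (0 : ℝ) < n := Nat.cast_pos.2 hn0
  rw [Function.comp_apply] at hn ⊢
  rw [sub_eq_add_neg, Real.rpow_add hn', mul_div_right_comm]
  gcongr
  linarith [Nat.sub_one_lt_floor ((n : ℝ) ^ β)]

end Assembly

end CSBM

theorem theorem1p3 {k : ℕ} (M : CSBM.Params k) (t : ℝ) (ht : 0 < t)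
    (htc : ENNReal.ofReal t < CSBM.criticalTime M)
    (est : ∀ n : ℕ, CSBM.Estimator n k) :
    Tendsto (fun n : ℕ => CSBM.recoveryProb M t n (est n)) atTop (𝓝 0) := by
  obtain ⟨i, j, hij, hlt⟩ := CSBM.exists_mul_chernoffHellinger_lt_one M ht htc
  obtain ⟨γ, hγ, η, hη, hD⟩ := CSBM.exists_le_graphLaw_real_crossFavours M ht hlt
  -- `β > γ` makes the number of free moves diverge, `β > 0` makes `s` diverge, and `β < 1` makes `s
  -- log n / n` vanish.
  obtain ⟨β, hβ, hβ1⟩ := exists_between (max_lt hγ zero_lt_one)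
  have hγβ : γ < β := (le_max_left _ _).trans_lt hβ
  have hβ0 : 0 < β := (le_max_right _ _).trans_lt hβ
  set s : ℕ → ℕ := fun n => ⌊(n : ℝ) ^ β⌋₊ with hs
  have hsn := CSBM.tendsto_floor_rpow_div hβ1
  have hsq := CSBM.tendsto_floor_rpow_mul_log_div t hβ1
  have hsb := CSBM.tendsto_floor_rpow_mul_rpow hβ0 hγβ
  have hs_top : Tendsto (fun n => (s n : ℝ)) atTop atTop := by
    simpa using CSBM.tendsto_floor_rpow_mul_rpow hβ0 hβ0
  have hlim : Tendsto (fun n : ℕ =>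
      (4 * k / η ^ 2 / n + 4 / M.ρ i ^ 2 / s n) +
        (8 / M.ρ i / (s n * (n : ℝ) ^ (-γ)) + 8 * (s n * (t * Real.log n / n))) +
        4 * k.factorial / (M.ρ i * M.ρ j) / (s n * (n : ℝ) ^ (-γ))) atTop (𝓝 0) := by
    have h := (((tendsto_natCast_atTop_atTop.const_div_atTop (4 * k / η ^ 2)).add
      (hs_top.const_div_atTop (4 / M.ρ i ^ 2))).add
      ((hsb.const_div_atTop (8 / M.ρ i)).add (hsq.const_mul 8))).add
      (hsb.const_div_atTop (4 * k.factorial / (M.ρ i * M.ρ j)))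
    simpa using h
  have hlim' := ENNReal.tendsto_ofReal hlim
  rw [ENNReal.ofReal_zero] at hlim'
  refine tendsto_of_tendsto_of_tendsto_of_le_of_le' tendsto_const_nhds hlim'
    (Eventually.of_forall fun n => zero_le) ?_
  filter_upwards [hD, CSBM.eventually_revealProb_eq ht, hsn.eventually_le_const (half_pos hη),
    hsn.eventually_le_const zero_lt_one, hs_top.eventually_gt_atTop 0, eventually_gt_atTop 0]
    with n hDn hqn hsη hs1 hs0 hn0
  have hn' : (0 : ℝ) < n := Nat.cast_pos.2 hn0
  rw [← hqn]
  exact CSBM.recoveryProb_le_ofReal M (Nat.cast_pos.1 hs0)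
    (by exact_mod_cast (div_le_one hn').1 hs1) hij hη hsη (Real.rpow_pos_of_pos hn' _)
    (fun σ v => hDn (s n) σ v) (est n)
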